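/- Let $T=(0,\tau)$ with $\tau>0$, let $(\Omega,\mathcal F,\mathbf P)$ be a probability space carrying a standard Brownian motion indexed by $L^2(T)$, i.e. a linear map $h\mapsto W(h)$ from $L^2(T)$ to $L^2(\Omega)$ such that every $W(h)$ is a centred Gaussian variable with variance $\|h\|^2_{L^2(T)}$ (the Wiener integral $W(h)=\int_T h\,dW$ of a Wiener process on $T$). Put $W(A)=W(1_A)$. For $n\ge 0$ let $I_n:L^2(T^n)\to L^2(\Omega)$ be the multiple Wiener–Itô integral of order $n$, i.e. the continuous extension of $$\sum c_{i_1,\dots,i_n}1_{A_{i_1}\times\cdots\times A_{i_n}}\ \longmapsto\ \sum c_{i_1,\dots,i_n}W(A_{i_1})\cdots W(A_{i_n}),$$ where the $A_i$ are finitely many pairwise disjoint Borel subsets of $T$ and $c_{i_1,\dots,i_n}=0$ whenever two indices are equal. Two random variables with chaos expansions $X=\sum_{n\ge0}I_n(f_n)$, $Y=\sum_{m\ge0}I_m(g_m)$ in $L^2(\Omega)$, where $f_n\in L^2(T^n)$ and $g_m\in L^2(T^m)$ are symmetric, are called strongly independent if $I_n(f_n)$ and $I_m(g_m)$ are independent for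 all $n,m\ge 0$. **Proposition.** There are $h_1,\dots,h_5\in L^2(T)$ with $\|h_i\|_{L^2(T)}=1$ such that $W(h_1),\dots,W(h_5)$ are pairwise independent. For any such $h_1,\dots,h_5$ put $$A=\tfrac12\big(W(h_1)^2+W(h_2)^2\big),\quad B=\tfrac12\big(W(h_4)^2+W(h_5)^2\big),\quad \varpi=\tfrac12\operatorname{sign}(W(h_3))+\tfrac12,$$ $$X=A-1,\qquad Y=2\varpi B-1.$$ Then $A$ and $B$ are exponentially distributed with parameter $1$, $\varpi$ has the Bernoulli distribution with parameter $\tfrac12$, and $A,B,\varpi$ are mutually independent. Moreover $X$ and $Y$ have chaos expansions and are strongly independent: every chaos component $I_n(f_n)$ of $X$ is independent of every chaos component $I_m(g_m)$ of $Y$. The expansion of $Y$ is infinite: infinitely many of its components $I_m(g_m)$ are nonzero. -/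

import Mathlib

open MeasureTheory ProbabilityTheory
open scoped ENNReal NNReal

noncomputable section

namespace WienerChaos

/-- Lebesgue measure on the time interval `T = (0, τ)`. -/
abbrev timeMeasure (τ : ℝ) : Measure ℝ := volume.restrict (Set.Ioo 0 τ)

/-- The Hilbert space `L²(T)`. -/
abbrev TimeL2 (τ : ℝ) : Type := Lp ℝ 2 (timeMeasure τ)

/-- The product measure on `T ^ n`. For `n = 0` this is the unit mass on a one-point space. -/
abbrev timeMeasurePi (τ : ℝ) (n : ℕ) : Measure (Fin n → ℝ) :=
  Measure.pi fun _ : Fin n => timeMeasure τ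

/-- The space `L²(T ^ n)` of kernels. -/
abbrev KernelL2 (τ : ℝ) (n : ℕ) : Type := Lp ℝ 2 (timeMeasurePi τ n)

/-- A kernel `f ∈ L²(T ^ n)` is symmetric if it is a.e. invariant under permutations of its
variables. -/
def IsSymmetricKernel {τ : ℝ} {n : ℕ} (f : KernelL2 τ n) : Prop :=
  ∀ σ : Equiv.Perm (Fin n), (fun t : Fin n → ℝ => f (fun i => t (σ i))) =ᵐ[timeMeasurePi τ n] f

variable {Ω : Type*} [MeasurableSpace Ω]

/-- A standard Brownian motion indexed by `L²(T)` (the Wiener integral `h ↦ W(h) = ∫ h dW` of a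
Wiener process on `T`): a linear map from `L²(T)` to `L²(Ω)` such that `W(h)` is a centred Gaussian
variable with variance `‖h‖²`. By linearity the family `(W(h))` is jointly Gaussian and
`E[W(g) W(h)] = ⟨g, h⟩`; the Wiener process itself is `W_t = W(1_(0,t))`. -/
def IsWienerIntegral {τ : ℝ} {P : Measure Ω} (W : TimeL2 τ →ₗ[ℝ] Lp ℝ 2 P) : Prop :=
  ∀ h : TimeL2 τ, HasLaw (W h) (gaussianReal 0 (‖h‖₊ ^ 2)) P

/-- `W(A) = W(1_A)` for a Borel set `A`. -/
def noise {τ : ℝ} {P : Measure Ω} (W : TimeL2 τ →ₗ[ℝ] Lp ℝ 2 P) {A : Set ℝ}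
    (hA : MeasurableSet A) : Ω → ℝ :=
  W (indicatorConstLp 2 hA (measure_ne_top (timeMeasure τ) A) (1 : ℝ))

/-- An elementary function of `n` variables on `T`:
`∑ c_{i₁,…,iₙ} 1_{A_{i₁} × ⋯ × A_{iₙ}}` with pairwise disjoint Borel subsets `A_i` of `T`, and
`c_{i₁,…,iₙ} = 0` as soon as two of the indices coincide. -/
structure ElementaryKernel (τ : ℝ) (n : ℕ) where
  /-- the number of sets -/
  p : ℕ
  /-- the sets `A_i` -/
  A : Fin p → Set ℝ
  /-- the coefficients -/
  c : (Fin n → Fin p) → ℝ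
  measurableSet_A : ∀ i, MeasurableSet (A i)
  A_subset : ∀ i, A i ⊆ Set.Ioo 0 τ
  disjoint_A : Pairwise fun i j => Disjoint (A i) (A j)
  c_eq_zero : ∀ i : Fin n → Fin p, ¬ Function.Injective i → c i = 0

/-- The function on `T ^ n` given by the data of an elementary kernel. -/
def ElementaryKernel.toFun {τ : ℝ} {n : ℕ} (e : ElementaryKernel τ n) : (Fin n → ℝ) → ℝ :=
  fun t => ∑ i : Fin n → Fin e.p, e.c i * ∏ k : Fin n, (e.A (i k)).indicator (fun _ => 1) (t k)

/-- The multiple integral of an elementary kernel,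
`∑ c_{i₁,…,iₙ} W(A_{i₁}) ⋯ W(A_{iₙ})`. -/
def ElementaryKernel.integral {τ : ℝ} {n : ℕ} {P : Measure Ω} (e : ElementaryKernel τ n)
    (W : TimeL2 τ →ₗ[ℝ] Lp ℝ 2 P) : Ω → ℝ :=
  fun ω => ∑ i : Fin n → Fin e.p,
    e.c i * ∏ k : Fin n, noise W (e.measurableSet_A (i k)) ω

/-- The graph, in `L²(T ^ n) × L²(Ω)`, of the multiple integral on elementary functions. -/
def elementaryGraph {τ : ℝ} {P : Measure Ω} (W : TimeL2 τ →ₗ[ℝ] Lp ℝ 2 P) (n : ℕ) :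
    Set (KernelL2 τ n × Lp ℝ 2 P) :=
  {q | ∃ e : ElementaryKernel τ n, q.1 =ᵐ[timeMeasurePi τ n] e.toFun ∧ q.2 =ᵐ[P] e.integral W}

open Classical in
/-- The multiple Wiener–Itô integral `I_n(f)`: the continuous extension to `L²(T ^ n)` of the
integral of elementary functions, i.e. the operator whose graph is the closure of the elementary
graph. (Elementary functions are dense in `L²(T ^ n)` and the elementary integral is bounded, so
exactly one `F` qualifies; the value `0` is never used.) -/
def multipleIntegral {τ : ℝ} {P : Measure Ω} (W : TimeL2 τ →ₗ[ℝ] Lp ℝ 2 P) (n : ℕ)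
    (f : KernelL2 τ n) : Lp ℝ 2 P :=
  if h : ∃ F : Lp ℝ 2 P, (f, F) ∈ closure (elementaryGraph W n) then h.choose else 0

/-- `X = ∑_{n ≥ 0} I_n(f_n)` in `L²(Ω)`, with symmetric kernels `f_n`. -/
def IsChaosExpansion {τ : ℝ} {P : Measure Ω} (W : TimeL2 τ →ₗ[ℝ] Lp ℝ 2 P)
    (f : ∀ n, KernelL2 τ n) (X : Ω → ℝ) : Prop :=
  (∀ n, IsSymmetricKernel (f n)) ∧
    ∃ F : Lp ℝ 2 P, F =ᵐ[P] X ∧ HasSum (fun n => multipleIntegral W n (f n)) F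

/-- `X` and `Y` are strongly independent: both have a chaos expansion, and every chaos component
of `X` is independent of every chaos component of `Y`. -/
def StronglyIndependent {τ : ℝ} {P : Measure Ω} (W : TimeL2 τ →ₗ[ℝ] Lp ℝ 2 P)
    (X Y : Ω → ℝ) : Prop :=
  (∃ f, IsChaosExpansion W f X) ∧ (∃ g, IsChaosExpansion W g Y) ∧
    ∀ f g, IsChaosExpansion W f X → IsChaosExpansion W g Y →
      ∀ n m, IndepFun (multipleIntegral W n (f n)) (multipleIntegral W m (g m)) P

/-- `h₁, …, h₅` are unit vectors of `L²(T)` with pairwise independent `W(h_i)`.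
(The vector `h_i` is `h (i - 1)`.) -/
def IsAdmissible {τ : ℝ} {P : Measure Ω} (W : TimeL2 τ →ₗ[ℝ] Lp ℝ 2 P)
    (h : Fin 5 → TimeL2 τ) : Prop :=
  (∀ i, ‖h i‖ = 1) ∧ Pairwise fun i j => IndepFun (W (h i)) (W (h j)) P

/-- `A = (W(h₁)² + W(h₂)²) / 2`. -/
def varA {τ : ℝ} {P : Measure Ω} (W : TimeL2 τ →ₗ[ℝ] Lp ℝ 2 P) (h : Fin 5 → TimeL2 τ) : Ω → ℝ :=
  fun ω => 1 / 2 * (W (h 0) ω ^ 2 + W (h 1) ω ^ 2)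

/-- `B = (W(h₄)² + W(h₅)²) / 2`. -/
def varB {τ : ℝ} {P : Measure Ω} (W : TimeL2 τ →ₗ[ℝ] Lp ℝ 2 P) (h : Fin 5 → TimeL2 τ) : Ω → ℝ :=
  fun ω => 1 / 2 * (W (h 3) ω ^ 2 + W (h 4) ω ^ 2)

/-- `ϖ = sign(W(h₃)) / 2 + 1 / 2`. -/
def varPi {τ : ℝ} {P : Measure Ω} (W : TimeL2 τ →ₗ[ℝ] Lp ℝ 2 P) (h : Fin 5 → TimeL2 τ) : Ω → ℝ :=
  fun ω => 1 / 2 * Real.sign (W (h 2) ω) + 1 / 2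

/-- `X = A - 1`. -/
def varX {τ : ℝ} {P : Measure Ω} (W : TimeL2 τ →ₗ[ℝ] Lp ℝ 2 P) (h : Fin 5 → TimeL2 τ) : Ω → ℝ :=
  fun ω => varA W h ω - 1

/-- `Y = 2 ϖ B - 1`. -/
def varY {τ : ℝ} {P : Measure Ω} (W : TimeL2 τ →ₗ[ℝ] Lp ℝ 2 P) (h : Fin 5 → TimeL2 τ) : Ω → ℝ :=
  fun ω => 2 * varPi W h ω * varB W h ω - 1

end WienerChaos

end

/-! Everything about laws and independence is Gaussian: `W` is linear, so finite families `W(u_i)`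
are jointly Gaussian, and for these zero covariance means independence. Pairwise independence of the
`W(h_i)` makes the `h_i` orthonormal, hence the `W(h_i)` mutually independent standard normals.

For strong independence, `X` is a function of `W(h₁), W(h₂)` and `Y` of `W(h₃), W(h₄), W(h₅)`. It
therefore suffices that the projection `J_n` onto the `n`-th chaos maps the square integrable
functions of `(W(u_i))_i` into themselves (`starProjection_mem_lpMeas`). This is tested on the
exponential vectors `exp(W(h) - ‖h‖²/2)` with `h` in the span of the `u_i`, which are total in that
space because exponential moments determine a law (`lpMeas_le_closure_span_wick`). If `φ` is
orthogonal to the space, then `⟨φ, wick(t h)⟩ = ∑ tⁿ ⟨φ, J_n wick(h)⟩` vanishes for all `t`, so each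
coefficient vanishes (`starProjection_wick_mem_lpMeas`).

The power series rests on `wick_chaos`: `J_n wick(t h) = tⁿ J_n wick(h)`. For step functions `h`,
`wick(h)` is the limit over refining grids of `∏ (1 + c_j W(A_j))`, whose `n`-th component is a
homogeneous polynomial of degree `n` in the `c_j`. The chaoses are orthogonal, and each of their
elements is a multiple integral with symmetric kernel, since the integral multiplies squared norms
of symmetric kernels by `n!`.

The expansion of `Y` is infinite because `t ↦ ⟨Y, wick(t h₃)⟩ = E[sign(W(h₃)) wick(t h₃)]` is
bounded by `1` and not constant. With finitely many nonzero components it would be a polynomial. -/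

namespace WienerChaos

/-! ### Joint Gaussianity, isometry and exponential vectors -/

section Gaussian

variable {Ω : Type*} [MeasurableSpace Ω] {P : Measure Ω} {τ : ℝ} {W : TimeL2 τ →ₗ[ℝ] Lp ℝ 2 P}

lemma norm_sq_eq_integral (F : Lp ℝ 2 P) : ‖F‖ ^ 2 = ∫ ω, F ω ^ 2 ∂P := by
  rw [← real_inner_self_eq_norm_sq, L2.inner_def]
  refine integral_congr_ae (.of_forall fun ω => ?_)
  simp [pow_two]

lemma inner_eq_integral (F G : Lp ℝ 2 P) : inner ℝ F G = ∫ ω, F ω * G ω ∂P := by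
  rw [L2.inner_def]
  refine integral_congr_ae (.of_forall fun ω => ?_)
  simp [mul_comm]

lemma IsWienerIntegral.integral_eq_zero (hW : IsWienerIntegral W) (h : TimeL2 τ) :
    ∫ ω, W h ω ∂P = 0 := by
  rw [(hW h).integral_eq]; simp

/-- A centred variable has its variance as squared norm; so `W` is a linear isometry and preserves
inner products. -/
lemma IsWienerIntegral.norm_map (hW : IsWienerIntegral W) (h : TimeL2 τ) : ‖W h‖ = ‖h‖ := by
  have h1 : Var[W h; P] = ‖h‖ ^ 2 := by
    rw [(hW h).variance_eq]; simp
  rw [variance_of_integral_eq_zero (hW h).aemeasurable (hW.integral_eq_zero h)] at h1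
  have h2 := norm_sq_eq_integral (W h)
  rw [h1] at h2
  exact (pow_left_inj₀ (norm_nonneg _) (norm_nonneg _) two_ne_zero).1 h2

lemma IsWienerIntegral.inner_map_map (hW : IsWienerIntegral W) (g h : TimeL2 τ) :
    inner ℝ (W g) (W h) = inner ℝ g h :=
  LinearIsometry.inner_map_map ⟨W, hW.norm_map⟩ g h

variable [IsProbabilityMeasure P]

lemma IsWienerIntegral.covariance_eq (hW : IsWienerIntegral W) (g h : TimeL2 τ) :
    cov[W g, W h; P] = inner ℝ g h := by
  rw [covariance_eq_sub (Lp.memLp _) (Lp.memLp _), hW.integral_eq_zero, ← hW.inner_map_map,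
    inner_eq_integral]
  simp

omit [IsProbabilityMeasure P] in
lemma map_sum_smul_ae {ι : Type*} [Fintype ι] (u : ι → TimeL2 τ) (c : ι → ℝ) :
    W (∑ i, c i • u i) =ᵐ[P] fun ω => ∑ i, c i * W (u i) ω := by
  have h2 : W (∑ i, c i • u i) = ∑ i, c i • W (u i) := by simp
  rw [h2]
  have h3 := Lp.coeFn_finsetSum Finset.univ (fun i => c i • W (u i))
  have h4 : ∀ᵐ ω ∂P, ∀ i, (c i • W (u i) : Lp ℝ 2 P) ω = c i * W (u i) ω :=
    ae_all_iff.2 fun i => by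
      filter_upwards [Lp.coeFn_smul (c i) (W (u i))] with ω hω
      rw [hω]; simp
  filter_upwards [h3, h4] with ω h3 h4
  rw [h3]; simp [h4]

omit [IsProbabilityMeasure P] in
-- A linear functional `L` of the vector is a.e. `W` of the combination with coefficients `L
-- (Pi.single i 1)`, hence Gaussian.
lemma IsWienerIntegral.hasGaussianLaw (hW : IsWienerIntegral W) {ι : Type*} [Fintype ι]
    (u : ι → TimeL2 τ) : HasGaussianLaw (fun ω i => W (u i) ω) P := by
  classical
  constructor
  refine isGaussian_of_map_eq_gaussianReal fun L => ⟨0, ‖∑ i, L (Pi.single i 1) • u i‖₊ ^ 2, ?_⟩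
  have hU : AEMeasurable (fun ω i => W (u i) ω) P :=
    aemeasurable_pi_lambda _ fun i => (hW (u i)).aemeasurable
  rw [AEMeasurable.map_map_of_aemeasurable (by fun_prop) hU, ← (hW _).map_eq]
  refine Measure.map_congr ?_
  filter_upwards [map_sum_smul_ae (W := W) u fun i => L (Pi.single i 1)] with ω hω
  rw [hω, Function.comp_apply]
  conv_lhs => rw [pi_eq_sum_univ' (fun i => W (u i) ω)]
  simp [map_sum, mul_comm]

lemma IsWienerIntegral.iIndepFun_of_orthogonal (hW : IsWienerIntegral W) {ι : Type*} [Fintype ι]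
    {u : ι → TimeL2 τ} (hu : Pairwise fun i j => inner ℝ (u i) (u j) = 0) :
    iIndepFun (fun i => (W (u i) : Ω → ℝ)) P :=
  (hW.hasGaussianLaw u).iIndepFun_of_covariance_eq_zero fun i j hij => by
    rw [hW.covariance_eq, hu hij]

/-- Together with joint Gaussianity this upgrades pairwise to mutual independence. -/
lemma IsWienerIntegral.inner_eq_zero_of_indepFun (hW : IsWienerIntegral W) {g h : TimeL2 τ}
    (hgh : IndepFun (W g) (W h) P) : inner ℝ g h = 0 := by
  rw [← hW.covariance_eq, hgh.covariance_eq_zero (Lp.memLp _) (Lp.memLp _)]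

lemma IsWienerIntegral.integrable_exp (hW : IsWienerIntegral W) (t : ℝ) (h : TimeL2 τ) :
    Integrable (fun ω => Real.exp (t * W h ω)) P := by
  rw [← mgf_pos_iff, mgf_gaussianReal (hW h).map_eq]
  positivity

omit [IsProbabilityMeasure P] in
lemma IsWienerIntegral.integral_exp (hW : IsWienerIntegral W) (h : TimeL2 τ) :
    ∫ ω, Real.exp (W h ω) ∂P = Real.exp (‖h‖ ^ 2 / 2) := by
  have := mgf_gaussianReal (hW h).map_eq 1
  simpa [mgf] using this

/-- `W(h) exp(t W(h))` has expectation `t ‖h‖² exp(t² ‖h‖² / 2)`. -/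
lemma IsWienerIntegral.integral_mul_exp (hW : IsWienerIntegral W) (t : ℝ) (h : TimeL2 τ) :
    ∫ ω, W h ω * Real.exp (t * W h ω) ∂P = t * ‖h‖ ^ 2 * Real.exp (t ^ 2 * ‖h‖ ^ 2 / 2) := by
  have huniv : integrableExpSet (W h) P = Set.univ :=
    Set.eq_univ_of_forall fun s => hW.integrable_exp s h
  -- The expectation is the derivative of the moment generating function, which is also known in
  -- closed form.
  have h1 := hasDerivAt_mgf (X := W h) (μ := P) (t := t) (by simp [huniv])
  have h2 : mgf (W h) P = fun s => Real.exp (‖h‖ ^ 2 * s ^ 2 / 2) := by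
    ext s; rw [mgf_gaussianReal (hW h).map_eq]; simp
  rw [h2] at h1
  have h3 : HasDerivAt (fun s : ℝ => Real.exp (‖h‖ ^ 2 * s ^ 2 / 2))
      (Real.exp (‖h‖ ^ 2 * t ^ 2 / 2) * (‖h‖ ^ 2 * (2 * t) / 2)) t := by
    have := ((((hasDerivAt_id t).pow 2).const_mul (‖h‖ ^ 2)).div_const 2).exp
    simpa using this
  rw [h1.unique h3]
  ring_nf

/-- The exponential vector `exp(W(h) - ‖h‖² / 2)`. -/
noncomputable def wickFun (W : TimeL2 τ →ₗ[ℝ] Lp ℝ 2 P) (h : TimeL2 τ) (ω : Ω) : ℝ :=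
  Real.exp (W h ω - ‖h‖ ^ 2 / 2)

lemma IsWienerIntegral.memLp_wickFun (hW : IsWienerIntegral W) (h : TimeL2 τ) :
    MemLp (wickFun W h) 2 P := by
  have hm : AEStronglyMeasurable (wickFun W h) P := by
    unfold wickFun
    exact (Real.measurable_exp.comp_aemeasurable
      ((hW h).aemeasurable.sub_const _)).aestronglyMeasurable
  rw [memLp_two_iff_integrable_sq hm]
  refine ((hW.integrable_exp 2 h).mul_const (Real.exp (-‖h‖ ^ 2))).congr (.of_forall fun ω => ?_)
  simp only [wickFun, ← Real.exp_add, ← Real.exp_nat_mul]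
  congr 1; push_cast; ring

/-- The exponential vector as an element of `L²(Ω)`. -/
noncomputable def IsWienerIntegral.wick (hW : IsWienerIntegral W) (h : TimeL2 τ) : Lp ℝ 2 P :=
  (hW.memLp_wickFun h).toLp _

lemma IsWienerIntegral.coeFn_wick (hW : IsWienerIntegral W) (h : TimeL2 τ) :
    hW.wick h =ᵐ[P] wickFun W h := MemLp.coeFn_toLp _

/-- The product of the exponentials is `exp(W(g + h))` up to a constant; of `‖g + h‖² / 2` the
normalizations leave only the cross term. -/
lemma IsWienerIntegral.inner_wick (hW : IsWienerIntegral W) (g h : TimeL2 τ) :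
    inner ℝ (hW.wick g) (hW.wick h) = Real.exp (inner ℝ g h) := by
  rw [inner_eq_integral]
  have h1 : (fun ω => hW.wick g ω * hW.wick h ω) =ᵐ[P]
      fun ω => Real.exp (W (g + h) ω) * Real.exp (-(‖g‖ ^ 2 / 2 + ‖h‖ ^ 2 / 2)) := by
    have h0 : W (g + h) =ᵐ[P] W g + W h := by rw [map_add]; exact Lp.coeFn_add _ _
    filter_upwards [hW.coeFn_wick g, hW.coeFn_wick h, h0] with ω h1 h2 h3
    rw [h1, h2, h3, wickFun, wickFun, ← Real.exp_add, ← Real.exp_add]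
    congr 1; simp; ring
  rw [integral_congr_ae h1, integral_mul_const, hW.integral_exp, ← Real.exp_add, norm_add_sq_real]
  congr 1; ring

lemma IsWienerIntegral.norm_wick_sub_sq (hW : IsWienerIntegral W) (g h : TimeL2 τ) :
    ‖hW.wick g - hW.wick h‖ ^ 2 =
      Real.exp (‖g‖ ^ 2) - 2 * Real.exp (inner ℝ g h) + Real.exp (‖h‖ ^ 2) := by
  rw [norm_sub_sq_real, hW.inner_wick, ← real_inner_self_eq_norm_sq, hW.inner_wick,
    ← real_inner_self_eq_norm_sq (hW.wick h), hW.inner_wick, real_inner_self_eq_norm_sq,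
    real_inner_self_eq_norm_sq]

/-- This extends statements about exponential vectors from step functions to all of `L²(T)`. -/
lemma IsWienerIntegral.continuous_wick (hW : IsWienerIntegral W) : Continuous hW.wick := by
  rw [continuous_iff_continuousAt]
  intro h
  rw [ContinuousAt, tendsto_iff_norm_sub_tendsto_zero]
  have h1 : Filter.Tendsto (fun g => ‖hW.wick g - hW.wick h‖ ^ 2) (nhds h) (nhds 0) := by
    simp_rw [hW.norm_wick_sub_sq]
    have : Continuous fun g : TimeL2 τ =>
      Real.exp (‖g‖ ^ 2) - 2 * Real.exp (inner ℝ g h) + Real.exp (‖h‖ ^ 2) := by fun_prop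
    convert this.tendsto h using 2
    rw [real_inner_self_eq_norm_sq]; ring
  simpa using h1.sqrt

end Gaussian

/-! ### Disjoint families, their completions and common refinements -/

section Families

/-- A family of pairwise disjoint Borel subsets of `T`. -/
structure IsDisjointFamily (τ : ℝ) {ι : Type*} (A : ι → Set ℝ) : Prop where
  measurableSet : ∀ i, MeasurableSet (A i)
  subset : ∀ i, A i ⊆ Set.Ioo 0 τ
  disjoint : Pairwise fun i j => Disjoint (A i) (A j)

/-- Coefficients that vanish as soon as two of the indices coincide. -/
def OffDiagonal {ι : Type*} {n : ℕ} (c : (Fin n → ι) → ℝ) : Prop :=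
  ∀ i, ¬ Function.Injective i → c i = 0

/-- Coefficients that are invariant under permutations of the indices. -/
def SymmetricCoeff {ι : Type*} {n : ℕ} (c : (Fin n → ι) → ℝ) : Prop :=
  ∀ (σ : Equiv.Perm (Fin n)) i, c (i ∘ σ) = c i

/-- The step function `∑ c_{i₁,…,iₙ} 1_{A_{i₁} × ⋯ × A_{iₙ}}`. -/
noncomputable def boxSum {ι : Type*} [Fintype ι] {n : ℕ} (A : ι → Set ℝ) (c : (Fin n → ι) → ℝ)
    (t : Fin n → ℝ) : ℝ :=
  ∑ i, c i * ∏ k, (A (i k)).indicator (fun _ => 1) (t k)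

variable {Ω : Type*} [MeasurableSpace Ω] {P : Measure Ω} {τ : ℝ} {ι κ : Type*}
  [Fintype ι] [Fintype κ] {n : ℕ}

/-- The polynomial `∑ c_{i₁,…,iₙ} W(A_{i₁}) ⋯ W(A_{iₙ})` in the noise. -/
noncomputable def noiseSum (W : TimeL2 τ →ₗ[ℝ] Lp ℝ 2 P) {A : ι → Set ℝ}
    (hA : ∀ i, MeasurableSet (A i)) (c : (Fin n → ι) → ℝ) (ω : Ω) : ℝ :=
  ∑ i, c i * ∏ k, noise W (hA (i k)) ω

variable {W : TimeL2 τ →ₗ[ℝ] Lp ℝ 2 P} {A : ι → Set ℝ} {B : κ → Set ℝ}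

/-- Reindexing by `Fin p`; completed and refined families are more naturally indexed by `Option` and
product types. -/
lemma exists_elementaryKernel (hA : IsDisjointFamily τ A) {c : (Fin n → ι) → ℝ}
    (hc : OffDiagonal c) :
    ∃ e : ElementaryKernel τ n, (SymmetricCoeff c → SymmetricCoeff e.c) ∧
      e.toFun = boxSum A c ∧ e.integral W = noiseSum W hA.measurableSet c := by
  classical
  let φ := Fintype.equivFin ι
  let ψ : (Fin n → ι) ≃ (Fin n → Fin (Fintype.card ι)) := (Equiv.refl _).arrowCongr φ
  refine ⟨⟨Fintype.card ι, A ∘ φ.symm, fun i => c (φ.symm ∘ i), fun i => hA.measurableSet _,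
    fun i => hA.subset _, fun i j hij => hA.disjoint (φ.symm.injective.ne hij),
    fun i hi => hc _ fun h => hi (Function.Injective.of_comp h)⟩, ?_, ?_, ?_⟩
  · intro h σ i
    exact h σ (φ.symm ∘ i)
  · ext t
    rw [ElementaryKernel.toFun, boxSum, ← ψ.sum_comp]
    refine Finset.sum_congr rfl fun i _ => ?_
    simp [ψ, Equiv.arrowCongr, Function.comp_def]
  · ext ω
    rw [ElementaryKernel.integral, noiseSum, ← ψ.sum_comp]
    refine Finset.sum_congr rfl fun i _ => ?_
    simp [ψ, Equiv.arrowCongr, Function.comp_def]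

lemma ElementaryKernel.isDisjointFamily (e : ElementaryKernel τ n) : IsDisjointFamily τ e.A :=
  ⟨e.measurableSet_A, e.A_subset, e.disjoint_A⟩

/-- The family completed by the complement of its union. -/
def completion (τ : ℝ) (A : ι → Set ℝ) : Option ι → Set ℝ
  | none => Set.Ioo 0 τ \ ⋃ i, A i
  | some i => A i

/-- Coefficients extended by zero to the completed family. -/
noncomputable def completionCoeff (c : (Fin n → ι) → ℝ) (i : Fin n → Option ι) : ℝ :=
  open Classical in ∑ j, if i = some ∘ j then c j else 0

lemma IsDisjointFamily.completion (hA : IsDisjointFamily τ A) :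
    IsDisjointFamily τ (completion τ A) := by
  refine ⟨?_, ?_, ?_⟩
  · rintro (_ | i)
    · exact measurableSet_Ioo.diff (MeasurableSet.iUnion hA.measurableSet)
    · exact hA.measurableSet i
  · rintro (_ | i)
    · exact Set.sdiff_subset
    · exact hA.subset i
  · rintro (_ | i) (_ | j) hij
    · exact absurd rfl hij
    · exact Set.disjoint_sdiff_left.mono_right (Set.subset_iUnion A j)
    · exact (Set.disjoint_sdiff_left.mono_right (Set.subset_iUnion A i)).symm
    · exact hA.disjoint fun h => hij (congrArg _ h)

/-- Since the completed family covers `T`, any set in `T` is the disjoint union of its intersections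
with it, so meeting with it only refines. -/
lemma iUnion_completion (hA : IsDisjointFamily τ A) : ⋃ i, completion τ A i = Set.Ioo 0 τ := by
  refine Set.Subset.antisymm (Set.iUnion_subset hA.completion.subset) fun x hx => ?_
  by_cases h : x ∈ ⋃ i, A i
  · obtain ⟨i, hi⟩ := Set.mem_iUnion.1 h
    exact Set.mem_iUnion.2 ⟨some i, hi⟩
  · exact Set.mem_iUnion.2 ⟨none, hx, h⟩

lemma OffDiagonal.completionCoeff {c : (Fin n → ι) → ℝ} (hc : OffDiagonal c) :
    OffDiagonal (completionCoeff c) := by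
  intro i hi
  refine Finset.sum_eq_zero fun j _ => ?_
  split_ifs with h
  · refine hc j fun hj => hi ?_
    rw [h]
    exact (Option.some_injective _).comp hj
  · rfl

lemma SymmetricCoeff.completionCoeff {c : (Fin n → ι) → ℝ} (hc : SymmetricCoeff c) :
    SymmetricCoeff (completionCoeff c) := by
  classical
  intro σ i
  rw [WienerChaos.completionCoeff, WienerChaos.completionCoeff,
    ← (σ.symm.arrowCongr (Equiv.refl ι)).sum_comp]
  refine Finset.sum_congr rfl fun j _ => ?_
  have h1 : (σ.symm.arrowCongr (Equiv.refl ι)) j = j ∘ σ := by ext; simp [Equiv.arrowCongr]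
  rw [h1, hc]
  have h2 : i ∘ σ = some ∘ j ∘ σ ↔ i = some ∘ j := by
    rw [← Function.comp_assoc]
    exact σ.surjective.injective_comp_right.eq_iff
  simp only [h2]

lemma sum_completionCoeff_mul (c : (Fin n → ι) → ℝ) (f : Fin n → Option ι → ℝ) :
    ∑ i, completionCoeff c i * ∏ k, f k (i k) = ∑ i, c i * ∏ k, f k (some (i k)) := by
  classical
  simp only [completionCoeff, Finset.sum_mul]
  rw [Finset.sum_comm]
  refine Finset.sum_congr rfl fun j _ => ?_
  simp [ite_mul]

lemma boxSum_completion (c : (Fin n → ι) → ℝ) :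
    boxSum (completion τ A) (completionCoeff c) = boxSum A c := by
  ext t
  exact sum_completionCoeff_mul c fun k i => (completion τ A i).indicator (fun _ => 1) (t k)

lemma noiseSum_completion (hA : IsDisjointFamily τ A) (c : (Fin n → ι) → ℝ) :
    noiseSum W hA.completion.measurableSet (completionCoeff c) = noiseSum W hA.measurableSet c := by
  ext ω
  exact sum_completionCoeff_mul c fun k i => noise W (hA.completion.measurableSet i) ω

/-- The family of all intersections `A_i ∩ B_j`. -/
def meet (A : ι → Set ℝ) (B : κ → Set ℝ) (p : ι × κ) : Set ℝ := A p.1 ∩ B p.2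

omit [Fintype ι] [Fintype κ] in
lemma IsDisjointFamily.meet (hA : IsDisjointFamily τ A) (hB : IsDisjointFamily τ B) :
    IsDisjointFamily τ (meet A B) := by
  refine ⟨fun p => (hA.measurableSet _).inter (hB.measurableSet _),
    fun p => Set.inter_subset_left.trans (hA.subset _), fun p q hpq => ?_⟩
  by_cases h : p.1 = q.1
  · exact (hB.disjoint fun h' => hpq (Prod.ext h h')).mono Set.inter_subset_right
      Set.inter_subset_right
  · exact (hA.disjoint h).mono Set.inter_subset_left Set.inter_subset_left

/-- The coefficients ignore the second components, so by distributivity the sum over these becomes a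
product of sums. This is why refining a family preserves step functions and noise polynomials. -/
lemma sum_fst_comp_mul (c : (Fin n → ι) → ℝ) (f : Fin n → ι × κ → ℝ) :
    ∑ m : Fin n → ι × κ, c (Prod.fst ∘ m) * ∏ k, f k (m k) =
      ∑ i, c i * ∏ k, ∑ j, f k (i k, j) := by
  classical
  rw [← (Equiv.arrowProdEquivProdArrow (Fin n) (fun _ => ι) (fun _ => κ)).symm.sum_comp,
    Fintype.sum_prod_type]
  refine Finset.sum_congr rfl fun i _ => ?_
  rw [Finset.prod_univ_sum, Fintype.piFinset_univ, Finset.mul_sum]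
  rfl

lemma sum_snd_comp_mul (c : (Fin n → κ) → ℝ) (f : Fin n → ι × κ → ℝ) :
    ∑ m : Fin n → ι × κ, c (Prod.snd ∘ m) * ∏ k, f k (m k) =
      ∑ j, c j * ∏ k, ∑ i, f k (i, j k) := by
  classical
  rw [← (Equiv.arrowProdEquivProdArrow (Fin n) (fun _ => ι) (fun _ => κ)).symm.sum_comp,
    Fintype.sum_prod_type, Finset.sum_comm]
  refine Finset.sum_congr rfl fun i _ => ?_
  rw [Finset.prod_univ_sum, Fintype.piFinset_univ, Finset.mul_sum]
  rfl

/-- A set covered by a disjoint family is the sum of its pieces. -/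
lemma indicator_eq_sum_inter (hB : IsDisjointFamily τ B) (hBT : ⋃ j, B j = Set.Ioo 0 τ)
    {S : Set ℝ} (hS : S ⊆ Set.Ioo 0 τ) (x : ℝ) :
    S.indicator (fun _ => (1 : ℝ)) x = ∑ j, (S ∩ B j).indicator (fun _ => 1) x := by
  classical
  by_cases hx : x ∈ S
  · obtain ⟨j, hj⟩ := Set.mem_iUnion.1 (hBT.symm ▸ hS hx : x ∈ ⋃ j, B j)
    rw [Finset.sum_eq_single j]
    · simp [hx, hj]
    · intro b _ hb
      exact Set.indicator_of_notMem
        (fun h => Set.disjoint_left.1 (hB.disjoint hb) h.2 hj) _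
    · simp
  · simp [hx]

/-- The indicator function `1_S` as an element of `L²(T)`. -/
noncomputable def timeIndicator (τ : ℝ) {S : Set ℝ} (hS : MeasurableSet S) : TimeL2 τ :=
  indicatorConstLp 2 hS (measure_ne_top (timeMeasure τ) S) (1 : ℝ)

lemma coeFn_timeIndicator {S : Set ℝ} (hS : MeasurableSet S) :
    timeIndicator τ hS =ᵐ[timeMeasure τ] S.indicator fun _ => 1 := indicatorConstLp_coeFn

lemma noise_congr (W : TimeL2 τ →ₗ[ℝ] Lp ℝ 2 P) {S S' : Set ℝ} (h : S = S') (hS : MeasurableSet S)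
    (hS' : MeasurableSet S') : noise W hS = noise W hS' := by
  subst h; rfl

lemma timeIndicator_eq_sum_inter (hB : IsDisjointFamily τ B) (hBT : ⋃ j, B j = Set.Ioo 0 τ)
    {S : Set ℝ} (hSm : MeasurableSet S) (hS : S ⊆ Set.Ioo 0 τ) :
    timeIndicator τ hSm = ∑ j, timeIndicator τ (hSm.inter (hB.measurableSet j)) := by
  ext1
  have h4 : ∀ᵐ x ∂(timeMeasure τ), ∀ j, timeIndicator τ (hSm.inter (hB.measurableSet j)) x =
      (S ∩ B j).indicator (fun _ => (1 : ℝ)) x := ae_all_iff.2 fun j => indicatorConstLp_coeFn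
  filter_upwards [h4, Lp.coeFn_finsetSum Finset.univ
      fun j => timeIndicator τ (hSm.inter (hB.measurableSet j)),
    coeFn_timeIndicator hSm] with x h4 h5 h6
  rw [h6, h5, Finset.sum_apply, indicator_eq_sum_inter hB hBT hS]
  exact Finset.sum_congr rfl fun j _ => (h4 j).symm

lemma noise_ae_eq_sum_inter (hB : IsDisjointFamily τ B) (hBT : ⋃ j, B j = Set.Ioo 0 τ)
    {S : Set ℝ} (hSm : MeasurableSet S) (hS : S ⊆ Set.Ioo 0 τ) :
    noise W hSm =ᵐ[P] fun ω => ∑ j, noise W (hSm.inter (hB.measurableSet j)) ω := by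
  have h := congrArg W (timeIndicator_eq_sum_inter hB hBT hSm hS)
  rw [map_sum] at h
  change (W (timeIndicator τ hSm) : Ω → ℝ) =ᵐ[P] _
  rw [h]
  filter_upwards [Lp.coeFn_finsetSum Finset.univ
    fun j => W (timeIndicator τ (hSm.inter (hB.measurableSet j)))] with ω hω
  rw [hω, Finset.sum_apply]
  rfl

lemma boxSum_meet_fst (hA : IsDisjointFamily τ A) (hB : IsDisjointFamily τ B)
    (hBT : ⋃ j, B j = Set.Ioo 0 τ) (c : (Fin n → ι) → ℝ) :
    boxSum (meet A B) (fun m => c (Prod.fst ∘ m)) = boxSum A c := by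
  ext t
  rw [boxSum, sum_fst_comp_mul c fun k p => (meet A B p).indicator (fun _ => 1) (t k), boxSum]
  refine Finset.sum_congr rfl fun i _ => ?_
  simp only [indicator_eq_sum_inter hB hBT (hA.subset _), meet]

lemma boxSum_meet_snd (hA : IsDisjointFamily τ A) (hB : IsDisjointFamily τ B)
    (hAT : ⋃ j, A j = Set.Ioo 0 τ) (c : (Fin n → κ) → ℝ) :
    boxSum (meet A B) (fun m => c (Prod.snd ∘ m)) = boxSum B c := by
  ext t
  rw [boxSum, sum_snd_comp_mul c fun k p => (meet A B p).indicator (fun _ => 1) (t k), boxSum]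
  refine Finset.sum_congr rfl fun i _ => ?_
  simp only [indicator_eq_sum_inter hA hAT (hB.subset _), meet, Set.inter_comm]

lemma noiseSum_meet_fst (hA : IsDisjointFamily τ A) (hB : IsDisjointFamily τ B)
    (hBT : ⋃ j, B j = Set.Ioo 0 τ) (c : (Fin n → ι) → ℝ) :
    noiseSum W (hA.meet hB).measurableSet (fun m => c (Prod.fst ∘ m)) =ᵐ[P]
      noiseSum W hA.measurableSet c := by
  have h : ∀ᵐ ω ∂P, ∀ i, noise W (hA.measurableSet i) ω =
      ∑ j, noise W ((hA.measurableSet i).inter (hB.measurableSet j)) ω :=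
    ae_all_iff.2 fun i => noise_ae_eq_sum_inter hB hBT _ (hA.subset i)
  filter_upwards [h] with ω hω
  rw [noiseSum, sum_fst_comp_mul c fun k p => noise W ((hA.meet hB).measurableSet p) ω, noiseSum]
  refine Finset.sum_congr rfl fun i _ => ?_
  simp only [hω]
  rfl

lemma noiseSum_meet_snd (hA : IsDisjointFamily τ A) (hB : IsDisjointFamily τ B)
    (hAT : ⋃ j, A j = Set.Ioo 0 τ) (c : (Fin n → κ) → ℝ) :
    noiseSum W (hA.meet hB).measurableSet (fun m => c (Prod.snd ∘ m)) =ᵐ[P]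
      noiseSum W hB.measurableSet c := by
  have h : ∀ᵐ ω ∂P, ∀ i, noise W (hB.measurableSet i) ω =
      ∑ j, noise W ((hB.measurableSet i).inter (hA.measurableSet j)) ω :=
    ae_all_iff.2 fun i => noise_ae_eq_sum_inter hA hAT _ (hB.subset i)
  filter_upwards [h] with ω hω
  rw [noiseSum, sum_snd_comp_mul c fun k p => noise W ((hA.meet hB).measurableSet p) ω, noiseSum]
  refine Finset.sum_congr rfl fun i _ => ?_
  congr 1
  refine Finset.prod_congr rfl fun k _ => ?_
  rw [hω]
  exact Finset.sum_congr rfl fun j _ => congrFun (noise_congr W (Set.inter_comm _ _) _ _) ω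

end Families

/-! ### Two kernels over one family -/

section CommonFamily

variable {Ω : Type*} [MeasurableSpace Ω] {P : Measure Ω} {τ : ℝ} {n m : ℕ}

/-- Two elementary kernels can be written over a common family of disjoint sets. -/
lemma exists_common_family (W : TimeL2 τ →ₗ[ℝ] Lp ℝ 2 P) (e : ElementaryKernel τ n)
    (e' : ElementaryKernel τ m) :
    ∃ (ι : Type) (_ : Fintype ι) (A : ι → Set ℝ) (hA : IsDisjointFamily τ A)
      (c : (Fin n → ι) → ℝ) (c' : (Fin m → ι) → ℝ), OffDiagonal c ∧ OffDiagonal c' ∧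
      (SymmetricCoeff e.c → SymmetricCoeff c) ∧ (SymmetricCoeff e'.c → SymmetricCoeff c') ∧
      boxSum A c = e.toFun ∧ boxSum A c' = e'.toFun ∧
      noiseSum W hA.measurableSet c =ᵐ[P] e.integral W ∧
      noiseSum W hA.measurableSet c' =ᵐ[P] e'.integral W := by
  have hA := e.isDisjointFamily
  have hB := e'.isDisjointFamily
  have hc : OffDiagonal e.c := e.c_eq_zero
  have hc' : OffDiagonal e'.c := e'.c_eq_zero
  refine ⟨Option (Fin e.p) × Option (Fin e'.p), inferInstance,
    meet (completion τ e.A) (completion τ e'.A),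
    hA.completion.meet hB.completion, fun i => completionCoeff e.c (Prod.fst ∘ i),
    fun i => completionCoeff e'.c (Prod.snd ∘ i), ?_⟩
  refine ⟨?_, ?_, ?_, ?_, ?_, ?_, ?_, ?_⟩
  -- A tuple of pairs with a repetition also has a repeated first component.
  · exact fun i hi => hc.completionCoeff _ fun h => hi (Function.Injective.of_comp h)
  · exact fun i hi => hc'.completionCoeff _ fun h => hi (Function.Injective.of_comp h)
  · exact fun h σ i => h.completionCoeff σ (Prod.fst ∘ i)
  · exact fun h σ i => h.completionCoeff σ (Prod.snd ∘ i)
  · rw [boxSum_meet_fst hA.completion hB.completion (iUnion_completion hB), boxSum_completion]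
    rfl
  · rw [boxSum_meet_snd hA.completion hB.completion (iUnion_completion hA), boxSum_completion]
    rfl
  · refine (noiseSum_meet_fst hA.completion hB.completion (iUnion_completion hB) _).trans ?_
    rw [noiseSum_completion hA]
    rfl
  · refine (noiseSum_meet_snd hA.completion hB.completion (iUnion_completion hA) _).trans ?_
    rw [noiseSum_completion hB]
    rfl

end CommonFamily

/-! ### Second moments of elementary integrals -/

section Moments

variable {Ω : Type*} [MeasurableSpace Ω] {P : Measure Ω}

/-- The joint law is a product measure, under which a product of integrable functions of separate
coordinates is integrable. -/
lemma iIndepFun_integrable_prod {ι : Type*} [Fintype ι] {X : ι → Ω → ℝ} (hX : iIndepFun X P)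
    (hi : ∀ i, Integrable (X i) P) : Integrable (fun ω => ∏ i, X i ω) P := by
  have := hX.isProbabilityMeasure
  have hm : ∀ i, AEMeasurable (X i) P := fun i => (hi i).aemeasurable
  have hU : AEMeasurable (fun ω i => X i ω) P := aemeasurable_pi_lambda _ hm
  have h1 : Integrable (fun x : ι → ℝ => ∏ i, x i) (P.map fun ω i => X i ω) := by
    rw [hX.map_fun_eq_pi_map hm]
    have := fun i => Measure.isProbabilityMeasure_map (hm i)
    refine Integrable.fintype_prod_dep (f := fun _ x => x) fun i => ?_
    exact (integrable_map_measure (by fun_prop) (hm i)).2 (hi i)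
  exact (integrable_map_measure h1.aestronglyMeasurable hU).1 h1

variable {τ : ℝ} {W : TimeL2 τ →ₗ[ℝ] Lp ℝ 2 P} {ι : Type*} [Fintype ι] {A : ι → Set ℝ} {n m : ℕ}

lemma norm_timeIndicator_sq {S : Set ℝ} (hS : MeasurableSet S) :
    ‖timeIndicator τ hS‖ ^ 2 = (timeMeasure τ).real S := by
  rw [← real_inner_self_eq_norm_sq, timeIndicator,
    L2.real_inner_indicatorConstLp_one_indicatorConstLp_one, Set.inter_self]

omit [Fintype ι] in
lemma IsDisjointFamily.inner_timeIndicator (hA : IsDisjointFamily τ A) {i j : ι} (hij : i ≠ j) :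
    inner ℝ (timeIndicator τ (hA.measurableSet i)) (timeIndicator τ (hA.measurableSet j)) = 0 := by
  rw [timeIndicator, timeIndicator, L2.real_inner_indicatorConstLp_one_indicatorConstLp_one,
    (hA.disjoint hij).inter_eq]
  simp

lemma IsWienerIntegral.integral_sq (hW : IsWienerIntegral W) (h : TimeL2 τ) :
    ∫ ω, W h ω * W h ω ∂P = ‖h‖ ^ 2 := by
  rw [← inner_eq_integral, hW.inner_map_map, real_inner_self_eq_norm_sq]

variable [IsProbabilityMeasure P]

lemma IsWienerIntegral.iIndepFun_noise (hW : IsWienerIntegral W) (hA : IsDisjointFamily τ A) :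
    iIndepFun (fun i => noise W (hA.measurableSet i)) P :=
  hW.iIndepFun_of_orthogonal fun _ _ hij => hA.inner_timeIndicator hij

open Classical in
-- Each noise variable occurs to the power 0, 1 or 2 according to its membership in `s` and `t`. The
-- expectation factors, and a power 1 contributes the factor 0, so only `s = t` survives.
lemma noise_moment_aux (hW : IsWienerIntegral W) (hA : IsDisjointFamily τ A) (s t : Finset ι) :
    Integrable (fun ω => (∏ a ∈ s, noise W (hA.measurableSet a) ω) *
      ∏ a ∈ t, noise W (hA.measurableSet a) ω) P ∧
    ∫ ω, (∏ a ∈ s, noise W (hA.measurableSet a) ω) *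
      ∏ a ∈ t, noise W (hA.measurableSet a) ω ∂P =
      if s = t then ∏ a ∈ s, (timeMeasure τ).real (A a) else 0 := by
  let f : ι → ℝ → ℝ := fun a x => (if a ∈ s then x else 1) * (if a ∈ t then x else 1)
  have hf : ∀ a, Measurable (f a) := fun a => by
    simp only [f]; split_ifs <;> fun_prop
  have hind := (hW.iIndepFun_noise hA).comp f hf
  have h1 : ∀ ω, (∏ a ∈ s, noise W (hA.measurableSet a) ω) *
      ∏ a ∈ t, noise W (hA.measurableSet a) ω = ∏ a, (f a ∘ noise W (hA.measurableSet a)) ω := by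
    intro ω
    simp only [f, Function.comp_apply, Finset.prod_mul_distrib, Finset.prod_ite_mem,
      Finset.univ_inter]
  have hL2 : ∀ a, MemLp (noise W (hA.measurableSet a)) 2 P := fun a => Lp.memLp _
  have hint : ∀ a, Integrable (f a ∘ noise W (hA.measurableSet a)) P := by
    intro a
    by_cases hs : a ∈ s <;> by_cases ht : a ∈ t
    · refine ((hL2 a).integrable_mul (hL2 a)).congr (.of_forall fun ω => ?_)
      simp [f, hs, ht]
    · refine ((hL2 a).integrable one_le_two).congr (.of_forall fun ω => ?_)
      simp [f, hs, ht]
    · refine ((hL2 a).integrable one_le_two).congr (.of_forall fun ω => ?_)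
      simp [f, hs, ht]
    · refine (integrable_const (1 : ℝ)).congr (.of_forall fun ω => ?_)
      simp [f, hs, ht]
  have hval : ∀ a, ∫ ω, (f a ∘ noise W (hA.measurableSet a)) ω ∂P =
      if a ∈ s then (if a ∈ t then (timeMeasure τ).real (A a) else 0)
        else (if a ∈ t then 0 else 1) := by
    intro a
    have h2 : ∫ ω, noise W (hA.measurableSet a) ω * noise W (hA.measurableSet a) ω ∂P =
        (timeMeasure τ).real (A a) :=
      (hW.integral_sq (timeIndicator τ (hA.measurableSet a))).trans (norm_timeIndicator_sq _)
    have h3 : ∫ ω, noise W (hA.measurableSet a) ω ∂P = 0 := hW.integral_eq_zero (timeIndicator τ (hA.measurableSet a))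
    by_cases hs : a ∈ s <;> by_cases ht : a ∈ t
    · simpa [f, hs, ht] using h2
    · simpa [f, hs, ht] using h3
    · simpa [f, hs, ht] using h3
    · simp [f, hs, ht]
  simp only [h1]
  refine ⟨iIndepFun_integrable_prod hind hint, ?_⟩
  rw [hind.integral_fun_prod_eq_prod_integral fun a => (hint a).aestronglyMeasurable]
  simp only [hval]
  split_ifs with hst
  · subst hst
    rw [← Finset.prod_subset (Finset.subset_univ s)]
    · exact Finset.prod_congr rfl fun a ha => by simp [ha]
    · intro a _ ha; simp [ha]
  · obtain ⟨a, ha⟩ : ∃ a, ¬ (a ∈ s ↔ a ∈ t) := by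
      by_contra! h
      exact hst (Finset.ext h)
    refine Finset.prod_eq_zero (Finset.mem_univ a) ?_
    by_cases hs : a ∈ s <;> by_cases ht : a ∈ t <;> simp_all

open Classical in
lemma integral_prod_noise (hW : IsWienerIntegral W) (hA : IsDisjointFamily τ A)
    {i : Fin n → ι} {j : Fin m → ι} (hi : Function.Injective i) (hj : Function.Injective j) :
    Integrable (fun ω => (∏ k, noise W (hA.measurableSet (i k)) ω) *
      ∏ k, noise W (hA.measurableSet (j k)) ω) P ∧
    ∫ ω, (∏ k, noise W (hA.measurableSet (i k)) ω) *
      ∏ k, noise W (hA.measurableSet (j k)) ω ∂P =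
      if Finset.univ.image i = Finset.univ.image j then
        ∏ k, (timeMeasure τ).real (A (i k)) else 0 := by
  have h := noise_moment_aux hW hA (Finset.univ.image i) (Finset.univ.image j)
  simpa only [Finset.prod_image hi.injOn, Finset.prod_image hj.injOn] using h

open Classical in
lemma integral_noiseSum_mul (hW : IsWienerIntegral W) (hA : IsDisjointFamily τ A)
    {c : (Fin n → ι) → ℝ} {c' : (Fin m → ι) → ℝ} (hc : OffDiagonal c) (hc' : OffDiagonal c') :
    Integrable (fun ω => noiseSum W hA.measurableSet c ω * noiseSum W hA.measurableSet c' ω) P ∧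
    ∫ ω, noiseSum W hA.measurableSet c ω * noiseSum W hA.measurableSet c' ω ∂P =
      ∑ i, ∑ j, c i * c' j * if Finset.univ.image i = Finset.univ.image j then
        ∏ k, (timeMeasure τ).real (A (i k)) else 0 := by
  have h1 : ∀ ω, noiseSum W hA.measurableSet c ω * noiseSum W hA.measurableSet c' ω =
      ∑ i, ∑ j, c i * c' j * ((∏ k, noise W (hA.measurableSet (i k)) ω) *
      ∏ k, noise W (hA.measurableSet (j k)) ω) := by
    intro ω
    rw [noiseSum, noiseSum, Finset.sum_mul_sum]
    refine Finset.sum_congr rfl fun i _ => Finset.sum_congr rfl fun j _ => by ring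
  have h2 : ∀ i j, Integrable (fun ω => c i * c' j * ((∏ k, noise W (hA.measurableSet (i k)) ω) *
      ∏ k, noise W (hA.measurableSet (j k)) ω)) P ∧
      ∫ ω, c i * c' j * ((∏ k, noise W (hA.measurableSet (i k)) ω) *
      ∏ k, noise W (hA.measurableSet (j k)) ω) ∂P =
      c i * c' j * if Finset.univ.image i = Finset.univ.image j then
        ∏ k, (timeMeasure τ).real (A (i k)) else 0 := by
    intro i j
    by_cases hi : Function.Injective i
    · by_cases hj : Function.Injective j
      · have h := integral_prod_noise hW hA hi hj
        exact ⟨h.1.const_mul _, by rw [integral_const_mul, h.2]⟩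
      · simp [hc' j hj]
    · simp [hc i hi]
  simp only [h1]
  refine ⟨integrable_finsetSum _ fun i _ => integrable_finsetSum _ fun j _ => (h2 i j).1, ?_⟩
  rw [integral_finsetSum _ fun i _ => integrable_finsetSum _ fun j _ => (h2 i j).1]
  refine Finset.sum_congr rfl fun i _ => ?_
  rw [integral_finsetSum _ fun j _ => (h2 i j).1]
  exact Finset.sum_congr rfl fun j _ => (h2 i j).2

/-- Elementary integrals of different orders are orthogonal. -/
lemma integral_noiseSum_mul_of_ne (hW : IsWienerIntegral W) (hA : IsDisjointFamily τ A)
    {c : (Fin n → ι) → ℝ} {c' : (Fin m → ι) → ℝ} (hc : OffDiagonal c) (hc' : OffDiagonal c')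
    (hnm : n ≠ m) :
    ∫ ω, noiseSum W hA.measurableSet c ω * noiseSum W hA.measurableSet c' ω ∂P = 0 := by
  classical
  rw [(integral_noiseSum_mul hW hA hc hc').2]
  refine Finset.sum_eq_zero fun i _ => Finset.sum_eq_zero fun j _ => ?_
  by_cases hi : Function.Injective i
  · by_cases hj : Function.Injective j
    · rw [if_neg, mul_zero]
      intro h
      have := congrArg Finset.card h
      rw [Finset.card_image_of_injective _ hi, Finset.card_image_of_injective _ hj] at this
      simp at this
      exact hnm this
    · simp [hc' j hj]
  · simp [hc i hi]

omit [IsProbabilityMeasure P] in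
open Classical in
-- Injective tuples with the same image differ by exactly one permutation of the positions.
lemma sum_image_eq_sum_perm {c : (Fin n → ι) → ℝ} (hc : OffDiagonal c) {i : Fin n → ι}
    (hi : Function.Injective i) (r : ℝ) :
    ∑ j, c j * (if Finset.univ.image i = Finset.univ.image j then r else 0) =
      ∑ σ : Equiv.Perm (Fin n), c (i ∘ σ) * r := by
  have hinj : Function.Injective fun σ : Equiv.Perm (Fin n) => i ∘ σ := fun σ σ' h =>
    Equiv.ext fun k => hi (congrFun h k)
  rw [← Finset.sum_image (f := fun j => c j * r) (s := Finset.univ)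
    (g := fun σ : Equiv.Perm (Fin n) => i ∘ σ) hinj.injOn]
  rw [← Finset.sum_subset (Finset.subset_univ
    (Finset.univ.image fun σ : Equiv.Perm (Fin n) => i ∘ σ))]
  · refine Finset.sum_congr rfl fun j hj => ?_
    obtain ⟨σ, -, rfl⟩ := Finset.mem_image.1 hj
    rw [if_pos]
    rw [← Finset.image_image, Finset.image_univ_equiv]
  · intro j _ hj
    by_cases hji : Function.Injective j
    · rw [if_neg, mul_zero]
      intro h
      apply hj
      have h1 : ∀ k, ∃ l, i l = j k := fun k => by
        have : j k ∈ Finset.univ.image i := h ▸ Finset.mem_image_of_mem _ (Finset.mem_univ k)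
        simpa using this
      choose g hg using h1
      have hgi : Function.Injective g := fun a b hab => hji (by rw [← hg, ← hg, hab])
      refine Finset.mem_image.2
        ⟨Equiv.ofBijective g (Finite.injective_iff_bijective.1 hgi), Finset.mem_univ _, ?_⟩
      ext k; simp [hg]
    · simp [hc j hji]

lemma integral_noiseSum_sq (hW : IsWienerIntegral W) (hA : IsDisjointFamily τ A)
    {c : (Fin n → ι) → ℝ} (hc : OffDiagonal c) :
    ∫ ω, noiseSum W hA.measurableSet c ω ^ 2 ∂P =
      ∑ i, ∑ σ : Equiv.Perm (Fin n), c i * c (i ∘ σ) * ∏ k, (timeMeasure τ).real (A (i k)) := by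
  classical
  simp only [pow_two]
  rw [(integral_noiseSum_mul hW hA hc hc).2]
  refine Finset.sum_congr rfl fun i _ => ?_
  by_cases hi : Function.Injective i
  · simp only [mul_assoc]
    rw [← Finset.mul_sum, sum_image_eq_sum_perm hc hi, Finset.mul_sum]
  · simp [hc i hi]

lemma memLp_noiseSum (hW : IsWienerIntegral W) (hA : IsDisjointFamily τ A)
    {c : (Fin n → ι) → ℝ} (hc : OffDiagonal c) :
    MemLp (noiseSum W hA.measurableSet c) 2 P := by
  have hm : AEStronglyMeasurable (noiseSum W hA.measurableSet c) P := by
    unfold noiseSum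
    refine Finset.aestronglyMeasurable_fun_sum _ fun i _ => ?_
    refine (Finset.aestronglyMeasurable_fun_prod _ fun k _ => ?_).const_mul _
    exact Lp.aestronglyMeasurable _
  rw [memLp_two_iff_integrable_sq hm]
  simpa only [pow_two] using (integral_noiseSum_mul hW hA hc hc).1

end Moments

/-! ### Norms of step kernels -/

section Boxes

variable {τ : ℝ} {ι : Type*} [Fintype ι] {A : ι → Set ℝ} {n : ℕ}

omit [Fintype ι] in
lemma integrable_box (hA : IsDisjointFamily τ A) (i : Fin n → ι) :
    Integrable (fun t : Fin n → ℝ => ∏ k, (A (i k)).indicator (fun _ => (1 : ℝ)) (t k))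
      (timeMeasurePi τ n) :=
  Integrable.fintype_prod_dep fun k =>
    (integrable_const (1 : ℝ)).indicator (hA.measurableSet (i k))

/-- Distinct tuples give disjoint boxes, so the cross terms vanish. -/
lemma boxSum_sq (hA : IsDisjointFamily τ A) (c : (Fin n → ι) → ℝ) (t : Fin n → ℝ) :
    boxSum A c t ^ 2 = ∑ i, c i ^ 2 * ∏ k, (A (i k)).indicator (fun _ => (1 : ℝ)) (t k) := by
  classical
  rw [boxSum, pow_two, Finset.sum_mul_sum]
  refine Finset.sum_congr rfl fun i _ => ?_
  rw [Finset.sum_eq_single i]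
  · rw [mul_mul_mul_comm, ← Finset.prod_mul_distrib, pow_two]
    congr 1
    refine Finset.prod_congr rfl fun k _ => ?_
    by_cases h : t k ∈ A (i k) <;> simp [h]
  · intro j _ hji
    obtain ⟨k, hk⟩ := Function.ne_iff.1 hji
    rw [mul_mul_mul_comm, ← Finset.prod_mul_distrib, Finset.prod_eq_zero (Finset.mem_univ k),
      mul_zero]
    by_cases h : t k ∈ A (i k)
    · simp [Set.disjoint_left.1 (hA.disjoint hk.symm) h]
    · simp [h]
  · simp

lemma memLp_boxSum (hA : IsDisjointFamily τ A) (c : (Fin n → ι) → ℝ) :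
    MemLp (boxSum A c) 2 (timeMeasurePi τ n) := by
  have hm : AEStronglyMeasurable (boxSum A c) (timeMeasurePi τ n) := by
    unfold boxSum
    exact Finset.aestronglyMeasurable_fun_sum _ fun i _ =>
      (integrable_box hA i).aestronglyMeasurable.const_mul _
  rw [memLp_two_iff_integrable_sq hm]
  simp only [boxSum_sq hA]
  exact integrable_finsetSum _ fun i _ => (integrable_box hA i).const_mul _

lemma integral_boxSum_sq (hA : IsDisjointFamily τ A) (c : (Fin n → ι) → ℝ) :
    ∫ t, boxSum A c t ^ 2 ∂timeMeasurePi τ n =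
      ∑ i, c i ^ 2 * ∏ k, (timeMeasure τ).real (A (i k)) := by
  simp only [boxSum_sq hA]
  rw [integral_finsetSum _ fun i _ => (integrable_box hA i).const_mul _]
  refine Finset.sum_congr rfl fun i _ => ?_
  rw [integral_const_mul, timeMeasurePi,
    integral_fintype_prod_eq_prod (fun k x => (A (i k)).indicator (fun _ => (1 : ℝ)) x)]
  congr 1
  refine Finset.prod_congr rfl fun k _ => ?_
  rw [integral_indicator (hA.measurableSet _)]
  simp

end Boxes

/-! ### Wiener chaoses and their representation by symmetric kernels -/

section Chaos

variable {Ω : Type*} [MeasurableSpace Ω] {P : Measure Ω} {τ : ℝ} {n m : ℕ}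

lemma boxSum_comp_perm {ι : Type*} [Fintype ι] {A : ι → Set ℝ} {c : (Fin n → ι) → ℝ}
    (hc : SymmetricCoeff c) (σ : Equiv.Perm (Fin n)) (t : Fin n → ℝ) :
    boxSum A c (fun i => t (σ i)) = boxSum A c t := by
  classical
  rw [boxSum, boxSum, ← (σ.symm.arrowCongr (Equiv.refl ι)).sum_comp]
  refine Finset.sum_congr rfl fun j _ => ?_
  have h1 : (σ.symm.arrowCongr (Equiv.refl ι)) j = j ∘ σ := by ext; simp [Equiv.arrowCongr]
  rw [h1, hc]
  congr 1
  exact Equiv.prod_comp σ fun k => (A (j k)).indicator (fun _ => (1 : ℝ)) (t k)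

/-- The average of the coefficients over all permutations of the indices. -/
noncomputable def symmetrize {ι : Type*} (c : (Fin n → ι) → ℝ) (i : Fin n → ι) : ℝ :=
  (n.factorial : ℝ)⁻¹ * ∑ σ : Equiv.Perm (Fin n), c (i ∘ σ)

lemma symmetricCoeff_symmetrize {ι : Type*} (c : (Fin n → ι) → ℝ) :
    SymmetricCoeff (symmetrize c) := by
  intro σ i
  rw [symmetrize, symmetrize, ← Equiv.sum_comp (Equiv.mulLeft σ) fun σ' : Equiv.Perm (Fin n) => c (i ∘ σ')]
  rfl

lemma OffDiagonal.symmetrize {ι : Type*} {c : (Fin n → ι) → ℝ} (hc : OffDiagonal c) :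
    OffDiagonal (symmetrize c) := by
  intro i hi
  rw [WienerChaos.symmetrize, Finset.sum_eq_zero, mul_zero]
  intro σ _
  refine hc _ fun h => hi ?_
  simpa [Function.comp_assoc] using h.comp σ.symm.injective

/-- A product of noises does not depend on the order of its factors. -/
lemma noiseSum_symmetrize (W : TimeL2 τ →ₗ[ℝ] Lp ℝ 2 P) {ι : Type*} [Fintype ι] {A : ι → Set ℝ}
    (hA : ∀ i, MeasurableSet (A i)) (c : (Fin n → ι) → ℝ) :
    noiseSum W hA (symmetrize c) = noiseSum W hA c := by
  classical
  ext ω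
  have h : ∀ σ : Equiv.Perm (Fin n), ∑ i : Fin n → ι, c (i ∘ σ) * ∏ k, noise W (hA (i k)) ω =
      noiseSum W hA c ω := by
    intro σ
    rw [noiseSum, ← (σ.arrowCongr (Equiv.refl ι)).sum_comp]
    refine Finset.sum_congr rfl fun j _ => ?_
    have h1 : (σ.arrowCongr (Equiv.refl ι)) j = j ∘ σ.symm := by ext; simp [Equiv.arrowCongr]
    rw [h1, Function.comp_assoc, Equiv.symm_comp_self, Function.comp_id]
    congr 1
    exact Equiv.prod_comp σ.symm fun k => noise W (hA (j k)) ω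
  rw [noiseSum]
  simp only [symmetrize, mul_assoc, Finset.sum_mul, Finset.mul_sum]
  rw [Finset.sum_comm]
  simp only [← Finset.mul_sum, h]
  rw [Finset.sum_const, Finset.card_univ, Fintype.card_perm, Fintype.card_fin, nsmul_eq_mul,
    inv_mul_cancel_left₀ (Nat.cast_ne_zero.2 n.factorial_ne_zero)]

/-- The graph of the multiple integral on elementary functions as a linear subspace; if `s` holds,
only elementary functions with symmetric coefficients are considered. -/
noncomputable def kernelSubmodule (W : TimeL2 τ →ₗ[ℝ] Lp ℝ 2 P) (n : ℕ) (s : Prop) :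
    Submodule ℝ (KernelL2 τ n × Lp ℝ 2 P) where
  carrier := {q | ∃ e : ElementaryKernel τ n, (s → SymmetricCoeff e.c) ∧
    q.1 =ᵐ[timeMeasurePi τ n] e.toFun ∧ q.2 =ᵐ[P] e.integral W}
  add_mem' := by
    rintro ⟨f, F⟩ ⟨f', F'⟩ ⟨e, hs, h1, h2⟩ ⟨e', hs', h1', h2'⟩
    obtain ⟨ι, _, A, hA, c, c', hc, hc', hsc, hsc', hb, hb', hn, hn'⟩ := exists_common_family W e e'
    obtain ⟨e'', hs'', h1'', h2''⟩ := exists_elementaryKernel (W := W) hA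
      (c := fun i => c i + c' i) (fun i hi => by simp [hc i hi, hc' i hi])
    refine ⟨e'', fun h => hs'' fun σ i => congrArg₂ (· + ·) (hsc (hs h) σ i) (hsc' (hs' h) σ i), ?_, ?_⟩
    · rw [h1'']
      filter_upwards [h1, h1', Lp.coeFn_add f f'] with t ht ht' h
      simp only [Prod.fst_add] at ht ht' ⊢
      rw [h, Pi.add_apply, ht, ht', ← hb, ← hb']
      simp only [boxSum, add_mul, Finset.sum_add_distrib]
    · rw [h2'']
      filter_upwards [h2, h2', Lp.coeFn_add F F', hn, hn'] with t ht ht' h hn hn'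
      simp only [Prod.snd_add] at ht ht' ⊢
      rw [h, Pi.add_apply, ht, ht', ← hn, ← hn']
      simp only [noiseSum, add_mul, Finset.sum_add_distrib]
  zero_mem' := by
    obtain ⟨e, hs, h1, h2⟩ := exists_elementaryKernel (W := W) (n := n) (τ := τ)
      (A := fun _ : Unit => ∅) (c := fun _ => 0)
      ⟨fun _ => MeasurableSet.empty, fun _ => Set.empty_subset _,
        fun i j hij => absurd rfl hij⟩ fun _ _ => rfl
    refine ⟨e, fun _ => hs fun _ _ => rfl, ?_, ?_⟩
    · rw [h1]
      filter_upwards [Lp.coeFn_zero ℝ 2 (timeMeasurePi τ n)] with t ht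
      simp only [Prod.fst_zero]
      rw [ht]; simp [boxSum]
    · rw [h2]
      filter_upwards [Lp.coeFn_zero ℝ 2 P] with t ht
      simp only [Prod.snd_zero]
      rw [ht]; simp [noiseSum]
  smul_mem' := by
    rintro r ⟨f, F⟩ ⟨e, hs, h1, h2⟩
    obtain ⟨e', hs', h1', h2'⟩ := exists_elementaryKernel (W := W) e.isDisjointFamily
      (c := fun i => r * e.c i) (fun i hi => by simp [e.c_eq_zero i hi])
    refine ⟨e', fun h => hs' fun σ i => congrArg (r * ·) (hs h σ i), ?_, ?_⟩
    · rw [h1']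
      filter_upwards [h1, Lp.coeFn_smul r f] with t ht h
      simp only [Prod.smul_fst] at ht ⊢
      rw [h, Pi.smul_apply, ht]
      simp only [boxSum, ElementaryKernel.toFun, Finset.mul_sum, smul_eq_mul, mul_assoc]
    · rw [h2']
      filter_upwards [h2, Lp.coeFn_smul r F] with t ht h
      simp only [Prod.smul_snd] at ht ⊢
      rw [h, Pi.smul_apply, ht]
      simp only [noiseSum, ElementaryKernel.integral, Finset.mul_sum, smul_eq_mul, mul_assoc]

lemma coe_kernelSubmodule_false (W : TimeL2 τ →ₗ[ℝ] Lp ℝ 2 P) (n : ℕ) :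
    (kernelSubmodule W n False : Set (KernelL2 τ n × Lp ℝ 2 P)) = elementaryGraph W n := by
  ext q
  simp [kernelSubmodule, elementaryGraph]

lemma kernelSubmodule_true_le (W : TimeL2 τ →ₗ[ℝ] Lp ℝ 2 P) (n : ℕ) :
    kernelSubmodule W n True ≤ kernelSubmodule W n False := by
  rintro q ⟨e, -, h⟩
  exact ⟨e, False.elim, h⟩

variable {W : TimeL2 τ →ₗ[ℝ] Lp ℝ 2 P}

lemma norm_sq_kernel {q : KernelL2 τ n × Lp ℝ 2 P} {e : ElementaryKernel τ n}
    (h : q.1 =ᵐ[timeMeasurePi τ n] e.toFun) :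
    ‖q.1‖ ^ 2 = ∑ i, e.c i ^ 2 * ∏ k, (timeMeasure τ).real (e.A (i k)) := by
  rw [norm_sq_eq_integral, ← integral_boxSum_sq e.isDisjointFamily e.c]
  refine integral_congr_ae ?_
  filter_upwards [h] with t ht
  rw [ht]; rfl

lemma norm_sq_integral [IsProbabilityMeasure P] (hW : IsWienerIntegral W) {q : KernelL2 τ n × Lp ℝ 2 P}
    {e : ElementaryKernel τ n} (h : q.2 =ᵐ[P] e.integral W) :
    ‖q.2‖ ^ 2 = ∑ i, ∑ σ : Equiv.Perm (Fin n),
      e.c i * e.c (i ∘ σ) * ∏ k, (timeMeasure τ).real (e.A (i k)) := by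
  rw [norm_sq_eq_integral, ← integral_noiseSum_sq hW e.isDisjointFamily e.c_eq_zero]
  refine integral_congr_ae ?_
  filter_upwards [h] with t ht
  rw [ht]; rfl

/-- By `ab ≤ (a² + b²) / 2` each of the `n!` permutations in the second moment contributes at most
the squared norm of the kernel. -/
lemma norm_sq_le_of_mem_kernelSubmodule [IsProbabilityMeasure P] (hW : IsWienerIntegral W) {s : Prop}
    {q : KernelL2 τ n × Lp ℝ 2 P} (hq : q ∈ kernelSubmodule W n s) :
    ‖q.2‖ ^ 2 ≤ n.factorial * ‖q.1‖ ^ 2 := by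
  classical
  obtain ⟨e, -, h1, h2⟩ := hq
  rw [norm_sq_kernel h1, norm_sq_integral hW h2, Finset.sum_comm]
  have h3 : ∀ σ : Equiv.Perm (Fin n),
      ∑ i : Fin n → Fin e.p, e.c (i ∘ σ) ^ 2 * ∏ k, (timeMeasure τ).real (e.A (i k)) =
      ∑ i, e.c i ^ 2 * ∏ k, (timeMeasure τ).real (e.A (i k)) := by
    intro σ
    rw [← (σ.symm.arrowCongr (Equiv.refl (Fin e.p))).sum_comp
      (fun i : Fin n → Fin e.p => e.c i ^ 2 * ∏ k, (timeMeasure τ).real (e.A (i k)))]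
    refine Finset.sum_congr rfl fun j _ => ?_
    have h1 : (σ.symm.arrowCongr (Equiv.refl (Fin e.p))) j = j ∘ σ := by
      ext; simp [Equiv.arrowCongr]
    rw [h1]
    congr 1
    exact (Equiv.prod_comp σ fun k => (timeMeasure τ).real (e.A (j k))).symm
  have h4 : ∀ σ : Equiv.Perm (Fin n),
      ∑ i, e.c i * e.c (i ∘ σ) * ∏ k, (timeMeasure τ).real (e.A (i k)) ≤
      ∑ i, e.c i ^ 2 * ∏ k, (timeMeasure τ).real (e.A (i k)) := by
    intro σ
    have h5 : ∀ i : Fin n → Fin e.p, e.c i * e.c (i ∘ σ) * ∏ k, (timeMeasure τ).real (e.A (i k)) ≤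
        (e.c i ^ 2 * ∏ k, (timeMeasure τ).real (e.A (i k)) +
          e.c (i ∘ σ) ^ 2 * ∏ k, (timeMeasure τ).real (e.A (i k))) / 2 := by
      intro i
      have hμ : 0 ≤ ∏ k, (timeMeasure τ).real (e.A (i k)) :=
        Finset.prod_nonneg fun _ _ => measureReal_nonneg
      nlinarith [mul_nonneg (sq_nonneg (e.c i - e.c (i ∘ σ))) hμ]
    refine (Finset.sum_le_sum fun i _ => h5 i).trans (le_of_eq ?_)
    rw [← Finset.sum_div, Finset.sum_add_distrib, h3]
    ring
  refine (Finset.sum_le_sum fun σ _ => h4 σ).trans (le_of_eq ?_)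
  rw [Finset.sum_const, Finset.card_univ, Fintype.card_perm, Fintype.card_fin, nsmul_eq_mul]

/-- For symmetric coefficients the `n!` contributions are equal. The resulting lower bound on the
integral is what makes its range closed. -/
lemma norm_sq_eq_of_mem_kernelSubmodule [IsProbabilityMeasure P] (hW : IsWienerIntegral W)
    {q : KernelL2 τ n × Lp ℝ 2 P} (hq : q ∈ kernelSubmodule W n True) :
    ‖q.2‖ ^ 2 = n.factorial * ‖q.1‖ ^ 2 := by
  obtain ⟨e, hs, h1, h2⟩ := hq
  rw [norm_sq_kernel h1, norm_sq_integral hW h2, Finset.mul_sum]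
  refine Finset.sum_congr rfl fun i _ => ?_
  simp only [hs trivial _ i]
  rw [Finset.sum_const, Finset.card_univ, Fintype.card_perm, Fintype.card_fin, nsmul_eq_mul, pow_two]

/-- The `n`-th Wiener chaos: the closed subspace generated by the elementary integrals. -/
noncomputable def chaos (W : TimeL2 τ →ₗ[ℝ] Lp ℝ 2 P) (n : ℕ) : Submodule ℝ (Lp ℝ 2 P) :=
  ((kernelSubmodule W n False).map (LinearMap.snd ℝ (KernelL2 τ n) (Lp ℝ 2 P))).topologicalClosure

lemma isClosed_chaos (n : ℕ) : IsClosed (chaos W n : Set (Lp ℝ 2 P)) :=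
  Submodule.isClosed_topologicalClosure _

instance : CompleteSpace (chaos W n) := (isClosed_chaos n).completeSpace_coe

lemma chaos_le_orthogonal [IsProbabilityMeasure P] (hW : IsWienerIntegral W) (hnm : n ≠ m) :
    chaos W n ≤ (chaos W m)ᗮ := by
  refine Submodule.topologicalClosure_minimal _ ?_ (Submodule.isClosed_orthogonal _)
  rw [chaos, Submodule.orthogonal_closure]
  rintro _ ⟨⟨f, F⟩, ⟨e, -, -, h⟩, rfl⟩
  rw [Submodule.mem_orthogonal]
  rintro _ ⟨⟨f', F'⟩, ⟨e', -, -, h'⟩, rfl⟩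
  simp only [LinearMap.snd_apply] at h h' ⊢
  obtain ⟨ι, _, A, hA, c, c', hc, hc', -, -, -, -, hn, hn'⟩ := exists_common_family W e e'
  rw [inner_eq_integral, ← integral_noiseSum_mul_of_ne hW hA hc' hc hnm.symm]
  refine integral_congr_ae ?_
  filter_upwards [h, h', hn, hn'] with ω h h' hn hn'
  rw [h, h', hn, hn']

lemma multipleIntegral_mem_chaos (f : KernelL2 τ n) : multipleIntegral W n f ∈ chaos W n := by
  rw [multipleIntegral]
  split_ifs with h
  · have h1 : (f, h.choose) ∈ closure (kernelSubmodule W n False : Set (KernelL2 τ n × Lp ℝ 2 P)) := by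
      rw [coe_kernelSubmodule_false]; exact h.choose_spec
    exact map_mem_closure (f := Prod.snd) continuous_snd h1 fun q hq => ⟨q, hq, rfl⟩
  -- The default value `0` also lies in the chaos.
  · exact zero_mem _

lemma norm_sq_le_of_mem_closure [IsProbabilityMeasure P] (hW : IsWienerIntegral W) {q : KernelL2 τ n × Lp ℝ 2 P}
    (hq : q ∈ (kernelSubmodule W n False).topologicalClosure) :
    ‖q.2‖ ^ 2 ≤ n.factorial * ‖q.1‖ ^ 2 := by
  have hcl : IsClosed {q : KernelL2 τ n × Lp ℝ 2 P | ‖q.2‖ ^ 2 ≤ n.factorial * ‖q.1‖ ^ 2} :=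
    isClosed_le (by fun_prop) (by fun_prop)
  exact closure_minimal (fun q hq => norm_sq_le_of_mem_kernelSubmodule hW hq) hcl hq

/-- The norm bound persists on the closure of the elementary graph, so two values over the same
kernel differ by an element of norm zero. -/
lemma multipleIntegral_eq [IsProbabilityMeasure P] (hW : IsWienerIntegral W) {f : KernelL2 τ n} {F : Lp ℝ 2 P}
    (h : (f, F) ∈ (kernelSubmodule W n False).topologicalClosure) :
    multipleIntegral W n f = F := by
  have h0 : ∃ F, (f, F) ∈ closure (elementaryGraph W n) := by
    rw [← coe_kernelSubmodule_false]; exact ⟨F, h⟩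
  rw [multipleIntegral, dif_pos h0]
  have h1 : (f, h0.choose) ∈ (kernelSubmodule W n False).topologicalClosure := by
    change _ ∈ closure (kernelSubmodule W n False : Set (KernelL2 τ n × Lp ℝ 2 P))
    rw [coe_kernelSubmodule_false]; exact h0.choose_spec
  have h2 := norm_sq_le_of_mem_closure hW (Submodule.sub_mem _ h1 h)
  simp only [Prod.mk_sub_mk, sub_self, norm_zero] at h2
  have h3 : ‖h0.choose - F‖ = 0 := by
    have := sq_nonneg ‖h0.choose - F‖
    exact pow_eq_zero_iff (two_ne_zero) |>.1 (le_antisymm (by simpa using h2) this)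
  exact sub_eq_zero.1 (norm_eq_zero.1 h3)

lemma measurePreserving_comp_perm (σ : Equiv.Perm (Fin n)) :
    MeasurePreserving (fun (t : Fin n → ℝ) i => t (σ i)) (timeMeasurePi τ n)
      (timeMeasurePi τ n) := by
  have h := measurePreserving_piCongrLeft (fun _ : Fin n => timeMeasure τ) σ.symm
  convert h using 1
  ext t i
  rw [MeasurableEquiv.coe_piCongrLeft, Equiv.piCongrLeft_apply_eq_cast]
  simp

/-- Symmetric kernels are the common fixed points of the isometries that permute the variables. -/
lemma isClosed_isSymmetricKernel : IsClosed {f : KernelL2 τ n | IsSymmetricKernel f} := by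
  have h : {f : KernelL2 τ n | IsSymmetricKernel f} = ⋂ σ : Equiv.Perm (Fin n),
      {f | Lp.compMeasurePreserving _ (measurePreserving_comp_perm σ) f = f} := by
    ext f
    simp only [Set.mem_ofPred_eq, Set.mem_iInter, IsSymmetricKernel]
    refine forall_congr' fun σ => ?_
    have h1 := Lp.coeFn_compMeasurePreserving f (measurePreserving_comp_perm (τ := τ) σ)
    rw [Lp.ext_iff]
    exact ⟨fun h => h1.trans h, fun h => h1.symm.trans h⟩
  rw [h]
  exact isClosed_iInter fun σ =>
    isClosed_eq (Lp.isometry_compMeasurePreserving _).continuous continuous_id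

lemma isSymmetricKernel_of_mem {q : KernelL2 τ n × Lp ℝ 2 P}
    (hq : q ∈ (kernelSubmodule W n True).topologicalClosure) : IsSymmetricKernel q.1 := by
  refine closure_minimal (t := {q : KernelL2 τ n × Lp ℝ 2 P | IsSymmetricKernel q.1}) ?_
    (isClosed_isSymmetricKernel.preimage continuous_fst) hq
  rintro q ⟨e, hs, h1, -⟩ σ
  filter_upwards [h1, (measurePreserving_comp_perm σ).quasiMeasurePreserving.ae h1] with t ht ht'
  rw [ht, ht']
  exact boxSum_comp_perm (hs trivial) σ t

lemma exists_mem_kernelSubmodule_true {q : KernelL2 τ n × Lp ℝ 2 P}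
    (hq : q ∈ kernelSubmodule W n False) : ∃ f, (f, q.2) ∈ kernelSubmodule W n True := by
  obtain ⟨e, -, h1, h2⟩ := hq
  have hc : OffDiagonal e.c := e.c_eq_zero
  obtain ⟨e', hs, h1', h2'⟩ := exists_elementaryKernel (W := W) e.isDisjointFamily hc.symmetrize
  refine ⟨(memLp_boxSum e.isDisjointFamily (symmetrize e.c)).toLp _, e',
    fun _ => hs (symmetricCoeff_symmetrize _), ?_, ?_⟩
  · rw [h1']
    exact MemLp.coeFn_toLp (memLp_boxSum e.isDisjointFamily (symmetrize e.c))
  · rw [h2', noiseSum_symmetrize]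
    exact h2

/-- Every element of the `n`-th chaos is a multiple integral with a symmetric kernel. -/
lemma exists_symmetric_multipleIntegral_eq [IsProbabilityMeasure P] (hW : IsWienerIntegral W) {F : Lp ℝ 2 P}
    (hF : F ∈ chaos W n) : ∃ f, IsSymmetricKernel f ∧ multipleIntegral W n f = F := by
  set S := (kernelSubmodule W n True).topologicalClosure with hS
  have hnorm : ∀ q ∈ S, ‖q.2‖ ^ 2 = n.factorial * ‖q.1‖ ^ 2 := by
    intro q hq
    have hcl : IsClosed {q : KernelL2 τ n × Lp ℝ 2 P | ‖q.2‖ ^ 2 = n.factorial * ‖q.1‖ ^ 2} :=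
      isClosed_eq (by fun_prop) (by fun_prop)
    exact closure_minimal (fun q hq => norm_sq_eq_of_mem_kernelSubmodule hW hq) hcl hq
  have : CompleteSpace S := (Submodule.isClosed_topologicalClosure _).completeSpace_coe
  -- The product carries the maximum norm and `n! ≥ 1`, so the second coordinate dominates on `S`.
  -- Projecting to it is therefore isometric, with closed range since `S` is complete; the range
  -- contains all elementary integrals.
  let φ : S →ₗ[ℝ] Lp ℝ 2 P := (LinearMap.snd ℝ (KernelL2 τ n) (Lp ℝ 2 P)).comp S.subtype
  have hφ : Isometry φ := by
    refine AddMonoidHomClass.isometry_of_norm φ fun q => ?_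
    have h1 := hnorm q q.2
    have h2 : ‖q.1.1‖ ≤ ‖q.1.2‖ := by
      refine le_of_sq_le_sq ?_ (norm_nonneg _)
      rw [h1]
      have : (1 : ℝ) ≤ n.factorial := by exact_mod_cast n.factorial_pos
      nlinarith [sq_nonneg ‖q.1.1‖]
    change ‖q.1.2‖ = ‖q.1‖
    rw [Prod.norm_def, max_eq_right h2]
  have hcl : IsClosed (Set.range φ) := hφ.isClosedEmbedding.isClosed_range
  have hmem : F ∈ Set.range φ := by
    refine closure_minimal ?_ hcl hF
    rintro _ ⟨q, hq, rfl⟩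
    obtain ⟨f, hf⟩ := exists_mem_kernelSubmodule_true hq
    exact ⟨⟨(f, q.2), Submodule.le_topologicalClosure _ hf⟩, rfl⟩
  obtain ⟨⟨q, hq⟩, rfl⟩ := hmem
  exact ⟨q.1, isSymmetricKernel_of_mem hq, multipleIntegral_eq hW
    (Submodule.topologicalClosure_mono (kernelSubmodule_true_le W n) hq)⟩

end Chaos

/-! ### Approximating exponential vectors by products of `1 + c_j W(A_j)` -/

section ProductApproximation

variable {Ω : Type*} [MeasurableSpace Ω] {P : Measure Ω} [IsProbabilityMeasure P] {τ : ℝ}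
  {W : TimeL2 τ →ₗ[ℝ] Lp ℝ 2 P} {ι : Type*} [Fintype ι] {A : ι → Set ℝ}

lemma toLp_noiseSum_mem_chaos (hW : IsWienerIntegral W) (hA : IsDisjointFamily τ A) {n : ℕ}
    {c : (Fin n → ι) → ℝ} (hc : OffDiagonal c) : (memLp_noiseSum hW hA hc).toLp _ ∈ chaos W n := by
  obtain ⟨e, -, h1, h2⟩ := exists_elementaryKernel (W := W) hA hc
  refine Submodule.le_topologicalClosure _
    ⟨((memLp_boxSum hA c).toLp _, (memLp_noiseSum hW hA hc).toLp _), ⟨e, False.elim, ?_, ?_⟩, rfl⟩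
  · rw [h1]; exact (memLp_boxSum hA c).coeFn_toLp
  · rw [h2]; exact (memLp_noiseSum hW hA hc).coeFn_toLp

omit [Fintype ι] in
lemma exists_mem_chaos_prod_noise [Finite ι] (hW : IsWienerIntegral W)
    (hA : IsDisjointFamily τ A) (s : Finset ι) :
    ∃ F ∈ chaos W s.card, F =ᵐ[P] fun ω => ∏ j ∈ s, noise W (hA.measurableSet j) ω := by
  classical
  have := Fintype.ofFinite ι
  -- One enumeration of `s` carries the only nonzero coefficient; it is injective, hence off the
  -- diagonal.
  let i₀ : Fin s.card → ι := fun k => (s.equivFin.symm k : ι)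
  have hi₀ : Function.Injective i₀ := Subtype.val_injective.comp s.equivFin.symm.injective
  have hc : OffDiagonal (fun i : Fin s.card → ι => if i = i₀ then (1 : ℝ) else 0) := by
    intro i hi
    exact if_neg fun h : i = i₀ => hi (h ▸ hi₀)
  refine ⟨(memLp_noiseSum hW hA hc).toLp _, toLp_noiseSum_mem_chaos hW hA hc, ?_⟩
  · filter_upwards [(memLp_noiseSum hW hA hc).coeFn_toLp] with ω hω
    rw [hω, noiseSum]
    simp only [ite_mul, one_mul, zero_mul, Finset.sum_ite_eq', Finset.mem_univ, if_true]
    rw [← Finset.prod_coe_sort s, ← Equiv.prod_comp s.equivFin.symm]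

/-- The product `∏ (1 + c_j W(A_j))` as an element of `L²(Ω)`. -/
noncomputable def prodVec (hW : IsWienerIntegral W) (hA : IsDisjointFamily τ A) (c : ι → ℝ) :
    Lp ℝ 2 P :=
  ∑ s : Finset ι, (∏ j ∈ s, c j) • (exists_mem_chaos_prod_noise hW hA s).choose

lemma coeFn_prodVec (hW : IsWienerIntegral W) (hA : IsDisjointFamily τ A) (c : ι → ℝ) :
    prodVec hW hA c =ᵐ[P] fun ω => ∏ j, (1 + c j * noise W (hA.measurableSet j) ω) := by
  have h : ∀ᵐ ω ∂P, ∀ s : Finset ι,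
      ((∏ j ∈ s, c j) • (exists_mem_chaos_prod_noise hW hA s).choose : Lp ℝ 2 P) ω =
      (∏ j ∈ s, c j) * ∏ j ∈ s, noise W (hA.measurableSet j) ω :=
    ae_all_iff.2 fun s => by
      filter_upwards [Lp.coeFn_smul (∏ j ∈ s, c j) (exists_mem_chaos_prod_noise hW hA s).choose,
        (exists_mem_chaos_prod_noise hW hA s).choose_spec.2] with ω h1 h2
      rw [h1, Pi.smul_apply, h2, smul_eq_mul]
  filter_upwards [h, Lp.coeFn_finsetSum Finset.univ fun s : Finset ι =>
    ((∏ j ∈ s, c j) • (exists_mem_chaos_prod_noise hW hA s).choose : Lp ℝ 2 P)] with ω h1 h2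
  rw [prodVec, h2, Finset.sum_apply, Finset.prod_one_add, Finset.powerset_univ]
  refine Finset.sum_congr rfl fun s _ => ?_
  rw [h1, Finset.prod_mul_distrib]

lemma prodVec_mem_iSup (hW : IsWienerIntegral W) (hA : IsDisjointFamily τ A) (c : ι → ℝ) :
    prodVec hW hA c ∈ ⨆ n, chaos W n :=
  Submodule.sum_mem _ fun s _ => Submodule.smul_mem _ _ <|
    Submodule.mem_iSup_of_mem s.card (exists_mem_chaos_prod_noise hW hA s).choose_spec.1

lemma starProjection_chaos_of_mem (hW : IsWienerIntegral W) {n m : ℕ} {F : Lp ℝ 2 P}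
    (hF : F ∈ chaos W m) : (chaos W n).starProjection F = if n = m then F else 0 := by
  split_ifs with h
  · subst h
    exact Submodule.starProjection_eq_self_iff.2 hF
  · exact (Submodule.starProjection_apply_eq_zero_iff _).2
      (chaos_le_orthogonal hW (Ne.symm h) hF)

/-- In the expanded product, the terms of the `n`-th chaos are those with `n` factors, and each
acquires `tⁿ`. -/
lemma starProjection_prodVec_smul (hW : IsWienerIntegral W) (hA : IsDisjointFamily τ A)
    (c : ι → ℝ) (n : ℕ) (t : ℝ) :
    (chaos W n).starProjection (prodVec hW hA fun j => t * c j) =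
      t ^ n • (chaos W n).starProjection (prodVec hW hA c) := by
  simp only [prodVec, map_sum, map_smul, Finset.smul_sum]
  refine Finset.sum_congr rfl fun s _ => ?_
  rw [starProjection_chaos_of_mem hW (exists_mem_chaos_prod_noise hW hA s).choose_spec.1]
  split_ifs with h
  · rw [Finset.prod_mul_distrib, Finset.prod_const, mul_smul, h]
  · simp

/-- The step function `∑ c_j 1_{A_j}`. -/
noncomputable def stepVec (hA : IsDisjointFamily τ A) (c : ι → ℝ) : TimeL2 τ :=
  ∑ j, c j • timeIndicator τ (hA.measurableSet j)

omit [IsProbabilityMeasure P] in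
lemma norm_stepVec_sq (hA : IsDisjointFamily τ A) (c : ι → ℝ) :
    ‖stepVec hA c‖ ^ 2 = ∑ j, c j ^ 2 * (timeMeasure τ).real (A j) := by
  classical
  rw [← real_inner_self_eq_norm_sq, stepVec, sum_inner]
  refine Finset.sum_congr rfl fun j _ => ?_
  rw [inner_sum, Finset.sum_eq_single j]
  · rw [real_inner_smul_left, real_inner_smul_right, real_inner_self_eq_norm_sq,
      norm_timeIndicator_sq]
    ring
  · intro k _ hk
    rw [real_inner_smul_left, real_inner_smul_right, hA.inner_timeIndicator hk.symm]
    simp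
  · simp

lemma coeFn_wick_stepVec (hW : IsWienerIntegral W) (hA : IsDisjointFamily τ A) (c : ι → ℝ) :
    hW.wick (stepVec hA c) =ᵐ[P] fun ω => ∏ j, Real.exp (c j * noise W (hA.measurableSet j) ω -
      c j ^ 2 * (timeMeasure τ).real (A j) / 2) := by
  filter_upwards [hW.coeFn_wick (stepVec hA c),
    map_sum_smul_ae (W := W) (fun j => timeIndicator τ (hA.measurableSet j)) c] with ω h1 h2
  rw [h1, wickFun, norm_stepVec_sq, ← Real.exp_sum, stepVec, h2, Finset.sum_sub_distrib,
    Finset.sum_div]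
  rfl

lemma integral_one_add_mul_noise_sq (hW : IsWienerIntegral W) {S : Set ℝ} (hS : MeasurableSet S)
    (c : ℝ) :
    ∫ ω, (1 + c * noise W hS ω) * (1 + c * noise W hS ω) ∂P =
      1 + c ^ 2 * (timeMeasure τ).real S := by
  have hL : MemLp (noise W hS) 2 P := Lp.memLp _
  have h1 : ∫ ω, noise W hS ω * noise W hS ω ∂P = (timeMeasure τ).real S :=
    (hW.integral_sq (timeIndicator τ hS)).trans (norm_timeIndicator_sq _)
  have h2 : ∫ ω, noise W hS ω ∂P = 0 := hW.integral_eq_zero (timeIndicator τ hS)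
  have i1 : Integrable (noise W hS) P := hL.integrable one_le_two
  have i2 : Integrable (fun ω => noise W hS ω * noise W hS ω) P := hL.integrable_mul hL
  have h3 : ∀ ω, (1 + c * noise W hS ω) * (1 + c * noise W hS ω) =
      (1 + (2 * c) * noise W hS ω) + c ^ 2 * (noise W hS ω * noise W hS ω) := fun ω => by ring
  have i3 : Integrable (fun ω => 1 + (2 * c) * noise W hS ω) P :=
    (integrable_const _).add (i1.const_mul _)
  simp only [h3]
  rw [integral_add i3 (i2.const_mul _), integral_add (integrable_const _) (i1.const_mul _), integral_const_mul, integral_const_mul,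
    h1, h2]
  simp

lemma integral_exp_mul_one_add_noise (hW : IsWienerIntegral W) {S : Set ℝ} (hS : MeasurableSet S)
    (c : ℝ) :
    ∫ ω, Real.exp (c * noise W hS ω - c ^ 2 * (timeMeasure τ).real S / 2) *
      (1 + c * noise W hS ω) ∂P = 1 + c ^ 2 * (timeMeasure τ).real S := by
  have h1 := hW.integral_mul_exp c (timeIndicator τ hS)
  rw [norm_timeIndicator_sq] at h1
  change ∫ ω, noise W hS ω * Real.exp (c * noise W hS ω) ∂P = _ at h1
  have h2 : ∫ ω, Real.exp (c * noise W hS ω) ∂P =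
      Real.exp (c ^ 2 * (timeMeasure τ).real S / 2) := by
    have := mgf_gaussianReal (hW (timeIndicator τ hS)).map_eq c
    rw [mgf] at this
    refine this.trans ?_
    congr 1
    simp [norm_timeIndicator_sq]
    ring
  have i1 : Integrable (fun ω => Real.exp (c * noise W hS ω)) P := hW.integrable_exp c _
  have huniv : integrableExpSet (noise W hS) P = Set.univ :=
    Set.eq_univ_of_forall fun s => hW.integrable_exp s (timeIndicator τ hS)
  have i2 : Integrable (fun ω => noise W hS ω * Real.exp (c * noise W hS ω)) P := by
    have := integrable_pow_mul_exp_of_mem_interior_integrableExpSet (X := noise W hS) (μ := P)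
      (v := c) (by simp [huniv]) 1
    simpa using this
  have h3 : ∀ ω, Real.exp (c * noise W hS ω - c ^ 2 * (timeMeasure τ).real S / 2) *
      (1 + c * noise W hS ω) = Real.exp (-(c ^ 2 * (timeMeasure τ).real S / 2)) *
        (Real.exp (c * noise W hS ω) + c * (noise W hS ω * Real.exp (c * noise W hS ω))) := by
    intro ω
    rw [sub_eq_add_neg, Real.exp_add]
    ring
  simp only [h3]
  rw [integral_const_mul, integral_add i1 (i2.const_mul _), integral_const_mul, h1, h2]
  have : Real.exp (-(c ^ 2 * (timeMeasure τ).real S / 2)) *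
    Real.exp (c ^ 2 * (timeMeasure τ).real S / 2) = 1 := by rw [← Real.exp_add]; simp
  linear_combination (1 + c ^ 2 * (timeMeasure τ).real S) * this

/-- By independence, the inner product of the two vectors and the squared norm of the second factor
into the same product, so only one copy of it remains. -/
lemma norm_wick_sub_prodVec_sq (hW : IsWienerIntegral W) (hA : IsDisjointFamily τ A) (c : ι → ℝ) :
    ‖hW.wick (stepVec hA c) - prodVec hW hA c‖ ^ 2 =
      Real.exp (∑ j, c j ^ 2 * (timeMeasure τ).real (A j)) -
        ∏ j, (1 + c j ^ 2 * (timeMeasure τ).real (A j)) := by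
  have hind := hW.iIndepFun_noise hA
  have hm : ∀ j, AEMeasurable (noise W (hA.measurableSet j)) P :=
    fun j => (hW (timeIndicator τ (hA.measurableSet j))).aemeasurable
  rw [norm_sub_sq_real, ← real_inner_self_eq_norm_sq, hW.inner_wick, real_inner_self_eq_norm_sq,
    norm_stepVec_sq]
  have h1 : inner ℝ (hW.wick (stepVec hA c)) (prodVec hW hA c) =
      ∏ j, (1 + c j ^ 2 * (timeMeasure τ).real (A j)) := by
    rw [inner_eq_integral]
    have h2 := hind.integral_fun_prod_comp (f := fun j x =>
      Real.exp (c j * x - c j ^ 2 * (timeMeasure τ).real (A j) / 2) * (1 + c j * x)) hm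
      (fun j => (Measurable.aestronglyMeasurable (by fun_prop)))
    simp only [integral_exp_mul_one_add_noise hW] at h2
    rw [← h2]
    refine integral_congr_ae ?_
    filter_upwards [coeFn_wick_stepVec hW hA c, coeFn_prodVec hW hA c] with ω h3 h4
    rw [h3, h4, Finset.prod_mul_distrib]
  have h2 : ‖prodVec hW hA c‖ ^ 2 = ∏ j, (1 + c j ^ 2 * (timeMeasure τ).real (A j)) := by
    rw [← real_inner_self_eq_norm_sq, inner_eq_integral]
    have h2 := hind.integral_fun_prod_comp (f := fun j x => (1 + c j * x) * (1 + c j * x)) hm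
      (fun j => (Measurable.aestronglyMeasurable (by fun_prop)))
    simp only [integral_one_add_mul_noise_sq hW] at h2
    rw [← h2]
    refine integral_congr_ae ?_
    filter_upwards [coeFn_prodVec hW hA c] with ω h4
    rw [h4, Finset.prod_mul_distrib]
  rw [h1, h2]
  ring

omit [IsProbabilityMeasure P] in
-- From `log (1 + x) ≥ 1 - 1 / (1 + x) = x / (1 + x) ≥ x - x²`.
lemma exp_sub_sq_le_one_add {x : ℝ} (hx : 0 ≤ x) : Real.exp (x - x ^ 2) ≤ 1 + x := by
  have h1 : 0 < 1 + x := by linarith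
  rw [← Real.le_log_iff_exp_le h1]
  refine le_trans ?_ (Real.one_sub_inv_le_log_of_pos h1)
  rw [le_sub_iff_add_le, ← le_sub_iff_add_le', inv_le_iff_one_le_mul₀ h1]
  nlinarith [pow_nonneg hx 3]

/-- With weights `x_j = c_j² |A_j| ≤ δ`, the loss `∑ x_j²` in the exponent is at most `δ ∑ x_j = δ
‖h‖²`, where `h` is the step vector. -/
lemma norm_wick_sub_prodVec_sq_le (hW : IsWienerIntegral W) (hA : IsDisjointFamily τ A)
    (c : ι → ℝ) {δ : ℝ} (hδ : ∀ j, c j ^ 2 * (timeMeasure τ).real (A j) ≤ δ) :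
    ‖hW.wick (stepVec hA c) - prodVec hW hA c‖ ^ 2 ≤
      Real.exp (‖stepVec hA c‖ ^ 2) -
        Real.exp (‖stepVec hA c‖ ^ 2 - δ * ‖stepVec hA c‖ ^ 2) := by
  rw [norm_wick_sub_prodVec_sq, norm_stepVec_sq]
  refine sub_le_sub_left ?_ _
  have h0 : ∀ j, 0 ≤ c j ^ 2 * (timeMeasure τ).real (A j) :=
    fun j => mul_nonneg (sq_nonneg _) measureReal_nonneg
  refine le_trans ?_ (Finset.prod_le_prod (fun j _ => (Real.exp_pos _).le)
    fun j _ => exp_sub_sq_le_one_add (h0 j))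
  rw [← Real.exp_sum, Real.exp_le_exp, Finset.sum_sub_distrib, Finset.mul_sum]
  refine sub_le_sub_left (Finset.sum_le_sum fun j _ => ?_) _
  rw [pow_two]
  exact mul_le_mul_of_nonneg_right (hδ j) (h0 j)

end ProductApproximation

/-! ### Uniform grids on `T` -/

section Grid

/-- The `k`-th cell of the uniform grid with `N` cells on `T`. -/
noncomputable def gridCell (τ : ℝ) (N : ℕ) (k : Fin N) : Set ℝ :=
  Set.Ioo 0 τ ∩ {x | ⌊x * N / τ⌋₊ = k}

lemma isDisjointFamily_gridCell (τ : ℝ) (N : ℕ) : IsDisjointFamily τ (gridCell τ N) := by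
  refine ⟨fun k => measurableSet_Ioo.inter ?_, fun k => Set.inter_subset_left, fun i j hij => ?_⟩
  · exact (Nat.measurable_floor.comp (by fun_prop : Measurable fun x : ℝ => x * N / τ))
      (measurableSet_singleton (k : ℕ))
  · refine Set.disjoint_left.2 fun x hx hx' => hij (Fin.ext ?_)
    exact hx.2.symm.trans hx'.2

lemma iUnion_gridCell {τ : ℝ} (hτ : 0 < τ) {N : ℕ} (hN : 0 < N) :
    ⋃ k, gridCell τ N k = Set.Ioo 0 τ := by
  refine Set.Subset.antisymm (Set.iUnion_subset fun k => Set.inter_subset_left) fun x hx => ?_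
  have hN' : (0 : ℝ) < N := Nat.cast_pos.2 hN
  have h1 : ⌊x * N / τ⌋₊ < N := by
    rw [Nat.floor_lt (by have := hx.1; positivity), div_lt_iff₀ hτ, mul_comm]
    exact mul_lt_mul_of_pos_left hx.2 hN'
  exact Set.mem_iUnion.2 ⟨⟨_, h1⟩, hx, rfl⟩

lemma measureReal_gridCell_le {τ : ℝ} (hτ : 0 < τ) {N : ℕ} (hN : 0 < N) (k : Fin N) :
    (timeMeasure τ).real (gridCell τ N k) ≤ τ / N := by
  have hN' : (0 : ℝ) < N := Nat.cast_pos.2 hN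
  have h1 : gridCell τ N k ⊆ Set.Ico (k * τ / N) (k * τ / N + τ / N) := by
    rintro x ⟨hx, hk⟩
    have h2 := (Nat.floor_eq_iff (by have := hx.1; positivity)).1 hk
    rw [le_div_iff₀ hτ, div_lt_iff₀ hτ] at h2
    refine ⟨?_, ?_⟩
    · rw [div_le_iff₀ hN']; exact h2.1
    · rw [← add_div, lt_div_iff₀ hN']; linarith [h2.2]
  calc (timeMeasure τ).real (gridCell τ N k)
      ≤ (volume : Measure ℝ).real (gridCell τ N k) := by
        refine ENNReal.toReal_mono ?_ (Measure.restrict_apply_le _ _)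
        exact ((measure_mono h1).trans_lt (by simp)).ne
    _ ≤ (volume : Measure ℝ).real (Set.Ico (k * τ / N) (k * τ / N + τ / N)) :=
        measureReal_mono h1 (by simp)
    _ = τ / N := by
        rw [Real.volume_real_Ico_of_le (by have := hτ; linarith [div_pos hτ hN'])]
        ring

end Grid

/-! ### Chaos components of exponential vectors -/

section WickDense

variable {Ω : Type*} [MeasurableSpace Ω] {P : Measure Ω} [IsProbabilityMeasure P] {τ : ℝ}
  {W : TimeL2 τ →ₗ[ℝ] Lp ℝ 2 P} {ι : Type*} [Fintype ι] {A : ι → Set ℝ}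

omit [IsProbabilityMeasure P] in
lemma stepVec_meet_gridCell (hτ : 0 < τ) (hA : IsDisjointFamily τ A) (c : ι → ℝ) {N : ℕ}
    (hN : 0 < N) :
    stepVec (hA.meet (isDisjointFamily_gridCell τ N)) (fun p => c p.1) = stepVec hA c := by
  rw [stepVec, stepVec, Fintype.sum_prod_type]
  refine Finset.sum_congr rfl fun i _ => ?_
  rw [timeIndicator_eq_sum_inter (isDisjointFamily_gridCell τ N) (iUnion_gridCell hτ hN)
    (hA.measurableSet i) (hA.subset i), Finset.smul_sum]
  rfl

omit [IsProbabilityMeasure P] in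
lemma stepVec_smul (hA : IsDisjointFamily τ A) (c : ι → ℝ) (t : ℝ) :
    stepVec hA (fun j => t * c j) = t • stepVec hA c := by
  simp only [stepVec, Finset.smul_sum, mul_smul]

/-- Refining by a grid leaves the step vector unchanged while the weights shrink to zero uniformly.
The shift `N + 1` avoids the empty grid. -/
lemma tendsto_prodVec_gridCell (hτ : 0 < τ) (hW : IsWienerIntegral W) (hA : IsDisjointFamily τ A)
    (c : ι → ℝ) :
    Filter.Tendsto (fun N : ℕ => prodVec hW (hA.meet (isDisjointFamily_gridCell τ (N + 1)))
      (fun p => c p.1)) Filter.atTop (nhds (hW.wick (stepVec hA c))) := by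
  set s := ‖stepVec hA c‖ ^ 2 with hs
  -- A crude bound for every `c_i²`; the weights over the refined family are then at most `C τ / (N
  -- + 1)`.
  set C := ∑ i, c i ^ 2 with hC
  have hb : ∀ N : ℕ, ‖prodVec hW (hA.meet (isDisjointFamily_gridCell τ (N + 1)))
      (fun p => c p.1) - hW.wick (stepVec hA c)‖ ^ 2 ≤
      Real.exp s - Real.exp (s - (C * τ) / ((N + 1 : ℕ) : ℝ) * s) := by
    intro N
    have h1 := norm_wick_sub_prodVec_sq_le hW (hA.meet (isDisjointFamily_gridCell τ (N + 1)))
      (fun p => c p.1) (δ := (C * τ) / ((N + 1 : ℕ) : ℝ)) ?_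
    · rwa [stepVec_meet_gridCell hτ hA c N.succ_pos, norm_sub_rev] at h1
    · rintro ⟨i, k⟩
      have h2 : (timeMeasure τ).real (meet A (gridCell τ (N + 1)) (i, k)) ≤
          τ / ((N + 1 : ℕ) : ℝ) :=
        (measureReal_mono Set.inter_subset_right).trans
          (measureReal_gridCell_le hτ N.succ_pos k)
      rw [mul_div_assoc]
      exact mul_le_mul (Finset.single_le_sum (f := fun i => c i ^ 2)
        (fun i _ => sq_nonneg (c i)) (Finset.mem_univ i)) h2 measureReal_nonneg
        (Finset.sum_nonneg fun i _ => sq_nonneg (c i))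
  have hlim : Filter.Tendsto (fun N : ℕ => Real.exp s -
      Real.exp (s - (C * τ) / ((N + 1 : ℕ) : ℝ) * s)) Filter.atTop (nhds 0) := by
    have h1 : Filter.Tendsto (fun N : ℕ => (C * τ) / ((N + 1 : ℕ) : ℝ)) Filter.atTop (nhds 0) :=
      (tendsto_const_div_atTop_nhds_zero_nat (C * τ)).comp (Filter.tendsto_add_atTop_nat 1)
    have h2 : Continuous fun x : ℝ => Real.exp s - Real.exp (s - x * s) := by fun_prop
    have h3 := (h2.tendsto 0).comp h1
    simpa [Function.comp_def] using h3
  rw [tendsto_iff_norm_sub_tendsto_zero]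
  have h4 := (squeeze_zero (fun N => sq_nonneg _) hb hlim).sqrt
  simpa using h4

lemma wick_stepVec_mem_closure (hτ : 0 < τ) (hW : IsWienerIntegral W) (hA : IsDisjointFamily τ A)
    (c : ι → ℝ) : hW.wick (stepVec hA c) ∈ (⨆ n, chaos W n).topologicalClosure :=
  mem_closure_of_tendsto (tendsto_prodVec_gridCell hτ hW hA c)
    (.of_forall fun _ => prodVec_mem_iSup hW _ _)

lemma starProjection_wick_smul_stepVec (hτ : 0 < τ) (hW : IsWienerIntegral W)
    (hA : IsDisjointFamily τ A) (c : ι → ℝ) (n : ℕ) (t : ℝ) :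
    (chaos W n).starProjection (hW.wick (t • stepVec hA c)) =
      t ^ n • (chaos W n).starProjection (hW.wick (stepVec hA c)) := by
  have hc : Continuous (chaos W n).starProjection := (chaos W n).starProjection.continuous
  have h1 := (hc.tendsto _).comp (tendsto_prodVec_gridCell hτ hW hA fun j => t * c j)
  have h2 := ((hc.tendsto _).comp (tendsto_prodVec_gridCell hτ hW hA c)).const_smul (t ^ n)
  rw [stepVec_smul] at h1
  refine tendsto_nhds_unique (h1.congr fun N => ?_) h2
  exact starProjection_prodVec_smul hW (hA.meet (isDisjointFamily_gridCell τ (N + 1)))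
    (fun p => c p.1) n t

omit [IsProbabilityMeasure P] in
lemma exists_eq_stepVec (f : Lp.simpleFunc ℝ 2 (timeMeasure τ)) :
    ∃ (A : (Lp.simpleFunc.toSimpleFunc f).range → Set ℝ) (hA : IsDisjointFamily τ A),
      (f : TimeL2 τ) = stepVec hA fun v => (v : ℝ) := by
  set g := Lp.simpleFunc.toSimpleFunc f with hg
  -- The level sets of the simple function, cut down to `T` because it is defined on all of `ℝ`.
  have hA : IsDisjointFamily τ fun v : g.range => Set.Ioo 0 τ ∩ g ⁻¹' {(v : ℝ)} :=
    ⟨fun v => measurableSet_Ioo.inter (g.measurableSet_preimage _), fun v => Set.inter_subset_left,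
      fun v w hvw => Set.disjoint_left.2 fun x hx hx' =>
        hvw (Subtype.ext (hx.2.symm.trans hx'.2))⟩
  refine ⟨_, hA, ?_⟩
  ext1
  have h1 : ∀ᵐ x ∂timeMeasure τ, ∀ v : g.range,
      ((v : ℝ) • timeIndicator τ (hA.measurableSet v) : TimeL2 τ) x =
      v * (Set.Ioo 0 τ ∩ g ⁻¹' {(v : ℝ)}).indicator (fun _ => (1 : ℝ)) x :=
    ae_all_iff.2 fun v => by
      filter_upwards [Lp.coeFn_smul (v : ℝ) (timeIndicator τ (hA.measurableSet v)),
        coeFn_timeIndicator (τ := τ) (hA.measurableSet v)] with x h1 h2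
      rw [h1, Pi.smul_apply, h2, smul_eq_mul]
  filter_upwards [Lp.simpleFunc.toSimpleFunc_eq_toFun f, h1,
    Lp.coeFn_finsetSum Finset.univ
      fun v : g.range => ((v : ℝ) • timeIndicator τ (hA.measurableSet v) : TimeL2 τ),
    ae_restrict_mem measurableSet_Ioo] with x h2 h3 h4 hx
  rw [← h2, stepVec, h4, Finset.sum_apply, Finset.sum_eq_single ⟨g x, g.mem_range_self x⟩]
  · rw [h3, Set.indicator_of_mem (s := Set.Ioo 0 τ ∩ g ⁻¹' {g x}) ⟨hx, rfl⟩, mul_one]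
  · intro v _ hv
    rw [h3, Set.indicator_of_notMem, mul_zero]
    rintro ⟨-, hv'⟩
    exact hv (Subtype.ext hv'.symm)
  · simp

/-- Exponential vectors lie in the closed sum of the chaoses, and their `n`-th components are
homogeneous of degree `n`. -/
lemma wick_chaos (hτ : 0 < τ) (hW : IsWienerIntegral W) (h : TimeL2 τ) :
    hW.wick h ∈ (⨆ n, chaos W n).topologicalClosure ∧ ∀ (n : ℕ) (t : ℝ),
      (chaos W n).starProjection (hW.wick (t • h)) =
        t ^ n • (chaos W n).starProjection (hW.wick h) := by
  have hw := hW.continuous_wick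
  -- Both properties are closed conditions on `h`, because `wick` and the projections are
  -- continuous.
  refine (Lp.simpleFunc.denseRange (E := ℝ) (p := 2) (μ := timeMeasure τ)
    (by simp)).induction_on h ?_ ?_
  · refine IsClosed.inter ?_ ?_
    · exact (Submodule.isClosed_topologicalClosure _).preimage hw
    · have h1 : ∀ (n : ℕ) (t : ℝ), IsClosed {h : TimeL2 τ |
          (chaos W n).starProjection (hW.wick (t • h)) =
            t ^ n • (chaos W n).starProjection (hW.wick h)} := fun n t =>
        isClosed_eq ((chaos W n).starProjection.continuous.comp
          (hw.comp (continuous_const_smul t)))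
          (continuous_const_smul (t ^ n) |>.comp ((chaos W n).starProjection.continuous.comp hw))
      have h2 := isClosed_iInter fun n => isClosed_iInter fun t => h1 n t
      simp only [← Set.ofPred_forall] at h2
      exact h2
  · intro f
    obtain ⟨A, hA, hf⟩ := exists_eq_stepVec f
    rw [hf]
    exact ⟨wick_stepVec_mem_closure hτ hW hA _,
      fun n t => starProjection_wick_smul_stepVec hτ hW hA _ n t⟩

end WickDense

/-! ### Existence and uniqueness of chaos expansions -/

section Expansion

variable {Ω : Type*} [MeasurableSpace Ω] {P : Measure Ω} [IsProbabilityMeasure P] {τ : ℝ}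
  {W : TimeL2 τ →ₗ[ℝ] Lp ℝ 2 P}

lemma orthogonalFamily_chaos (hW : IsWienerIntegral W) :
    OrthogonalFamily ℝ (fun n => chaos W n) fun n => (chaos W n).subtypeₗᵢ := by
  intro n m hnm F G
  exact (Submodule.mem_orthogonal' _ _).1 (chaos_le_orthogonal hW hnm F.2) G G.2

/-- The components of an orthogonal expansion along the chaoses are the projections. -/
lemma eq_starProjection_of_hasSum (hW : IsWienerIntegral W) {G : ℕ → Lp ℝ 2 P}
    (hG : ∀ n, G n ∈ chaos W n) {F : Lp ℝ 2 P} (h : HasSum G F) (n : ℕ) :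
    G n = (chaos W n).starProjection F := by
  have h1 := h.mapL (chaos W n).starProjection
  have h2 : ∀ m, m ≠ n → (chaos W n).starProjection (G m) = 0 := fun m hm => by
    rw [starProjection_chaos_of_mem hW (hG m), if_neg hm.symm]
  have h3 := hasSum_single n h2
  rw [starProjection_chaos_of_mem hW (hG n), if_pos rfl] at h3
  exact h3.unique h1

/-- The closed sum of an orthogonal family is the isometric image of its Hilbert sum, and the
coordinates there are the projections. -/
lemma hasSum_starProjection_chaos (hW : IsWienerIntegral W) {F : Lp ℝ 2 P}
    (hF : F ∈ (⨆ n, chaos W n).topologicalClosure) :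
    HasSum (fun n => (chaos W n).starProjection F) F := by
  have hV := orthogonalFamily_chaos hW
  have h1 := hV.range_linearIsometry
  simp only [Submodule.subtypeₗᵢ_toLinearMap, Submodule.range_subtype] at h1
  rw [← h1] at hF
  obtain ⟨w, rfl⟩ := hF
  have h2 := hV.hasSum_linearIsometry w
  have h3 := fun n => eq_starProjection_of_hasSum hW (fun n => (w n).2) h2 n
  exact (funext h3 : (fun n => (w n : Lp ℝ 2 P)) = _) ▸ h2

lemma exists_isChaosExpansion (hW : IsWienerIntegral W) {F : Lp ℝ 2 P}
    (hF : F ∈ (⨆ n, chaos W n).topologicalClosure) {X : Ω → ℝ} (hX : F =ᵐ[P] X) :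
    ∃ f, IsChaosExpansion W f X := by
  choose f hf hf' using fun n => exists_symmetric_multipleIntegral_eq (n := n) hW
    ((chaos W n).starProjection_apply_mem F)
  refine ⟨f, hf, F, hX, ?_⟩
  simp only [hf']
  exact hasSum_starProjection_chaos hW hF

/-- The components depend only on the variable, so claims about all its expansions become claims
about projections. -/
lemma IsChaosExpansion.multipleIntegral_eq (hW : IsWienerIntegral W) {F : Lp ℝ 2 P}
    {X : Ω → ℝ} (hX : F =ᵐ[P] X) {f : ∀ n, KernelL2 τ n} (hf : IsChaosExpansion W f X) (n : ℕ) :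
    multipleIntegral W n (f n) = (chaos W n).starProjection F := by
  obtain ⟨-, F', hF', hs⟩ := hf
  have : F' = F := Lp.ext (hF'.trans hX.symm)
  subst this
  exact eq_starProjection_of_hasSum hW (fun n => multipleIntegral_mem_chaos (f n)) hs n

/-- Pairing a chaos expansion with exponential vectors gives a power series. -/
lemma hasSum_inner_wick (hτ : 0 < τ) (hW : IsWienerIntegral W) (F : Lp ℝ 2 P) (h : TimeL2 τ)
    (t : ℝ) :
    HasSum (fun n => t ^ n * inner ℝ F ((chaos W n).starProjection (hW.wick h)))
      (inner ℝ F (hW.wick (t • h))) := by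
  have h1 := (hasSum_starProjection_chaos hW (wick_chaos hτ hW (t • h)).1).mapL (innerSL ℝ F)
  simpa only [(wick_chaos hτ hW h).2, innerSL_apply_apply, inner_smul_right, map_smul,
    smul_eq_mul] using h1

end Expansion

/-! ### Exponential moments determine measures -/

section Separation

variable {Ω : Type*} [MeasurableSpace Ω]

/-- Finite measures under which `X` has the same finite exponential moments give `X` the same
distribution. -/
lemma map_eq_of_integral_exp_eq {μ ν : Measure Ω} [IsFiniteMeasure μ] [IsFiniteMeasure ν]
    {X : Ω → ℝ} (hX : Measurable X) (hμ : ∀ t, Integrable (fun ω => Real.exp (t * X ω)) μ)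
    (h : ∀ t, ∫ ω, Real.exp (t * X ω) ∂μ = ∫ ω, Real.exp (t * X ω) ∂ν) :
    μ.map X = ν.map X := by
  refine Measure.ext_of_complexMGF_eq hX.aemeasurable hX.aemeasurable ?_
  have huniv : integrableExpSet X μ = Set.univ := Set.eq_univ_of_forall hμ
  have h0 := h 0
  simp only [zero_mul, Real.exp_zero, integral_const, smul_eq_mul, mul_one] at h0
  have hiff : μ = 0 ↔ ν = 0 := by
    rw [← Measure.measure_univ_eq_zero, ← Measure.measure_univ_eq_zero,
      ← measureReal_eq_zero_iff, ← measureReal_eq_zero_iff, h0]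
  ext z
  -- Equality on the real line extends analytically to the complex plane, as the exponentials are
  -- integrable for every real `t`.
  exact eqOn_complexMGF_of_mgf' (funext h) hiff (by simp [huniv])

/-- The Cramér–Wold device: a law on a finite product is determined by its images under linear
functionals, which reduces the claim to one dimension. -/
lemma map_pi_eq_of_integral_exp_eq {ι : Type*} [Fintype ι] {μ ν : Measure Ω} [IsFiniteMeasure μ]
    [IsFiniteMeasure ν] {U : Ω → ι → ℝ} (hU : Measurable U)
    (hμ : ∀ a : ι → ℝ, Integrable (fun ω => Real.exp (∑ i, a i * U ω i)) μ)
    (h : ∀ a : ι → ℝ, ∫ ω, Real.exp (∑ i, a i * U ω i) ∂μ =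
      ∫ ω, Real.exp (∑ i, a i * U ω i) ∂ν) : μ.map U = ν.map U := by
  classical
  refine Measure.ext_of_charFunDual ?_
  ext L
  have hL : ∀ t ω, t * (L ∘ U) ω = ∑ i, (t * L (Pi.single i 1)) * U ω i := by
    intro t ω
    rw [Function.comp_apply]
    conv_lhs => rw [pi_eq_sum_univ' (U ω)]
    rw [map_sum, Finset.mul_sum]
    refine Finset.sum_congr rfl fun i _ => ?_
    rw [map_smul, smul_eq_mul]
    ring
  rw [charFunDual_eq_charFun_map_one, charFunDual_eq_charFun_map_one,
    Measure.map_map (by fun_prop) hU, Measure.map_map (by fun_prop) hU]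
  rw [map_eq_of_integral_exp_eq (μ := μ) (ν := ν) (L.continuous.measurable.comp hU) (fun t => ?_) (fun t => ?_)]
  · simp only [hL]
    exact hμ _
  · simp only [hL]
    exact h _

lemma isFiniteMeasure_withDensity_ofReal_of_integrable {μ : Measure Ω} {f : Ω → ℝ}
    (hf : Integrable f μ) : IsFiniteMeasure (μ.withDensity fun ω => ENNReal.ofReal (f ω)) :=
  isFiniteMeasure_withDensity_ofReal hf.2

/-- A function of `U` whose product with all exponentials of linear forms in `U` integrates to
zero vanishes almost surely. -/
lemma ae_eq_zero_of_integral_exp_mul_eq_zero {ι : Type*} [Fintype ι] {P : Measure Ω}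
    [IsFiniteMeasure P] {U : Ω → ι → ℝ} (hU : Measurable U) {Z : Ω → ℝ}
    (hZm : AEStronglyMeasurable[MeasurableSpace.comap U inferInstance] Z P)
    (hZ' : Measurable Z)
    (hint : ∀ a : ι → ℝ, Integrable (fun ω => Real.exp (∑ i, a i * U ω i) * Z ω) P)
    (h : ∀ a : ι → ℝ, ∫ ω, Real.exp (∑ i, a i * U ω i) * Z ω ∂P = 0) :
    Z =ᵐ[P] 0 := by
  have hZ : Integrable Z P := by simpa using hint 0
  have hpos : ∀ x : ℝ, (ENNReal.ofReal x).toReal = max x 0 := fun x => ENNReal.toReal_ofReal'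
  have := isFiniteMeasure_withDensity_ofReal_of_integrable hZ
  have := isFiniteMeasure_withDensity_ofReal_of_integrable hZ.neg
  have hm1 : Measurable fun ω => ENNReal.ofReal (Z ω) := by fun_prop
  have hm2 : Measurable fun ω => ENNReal.ofReal ((-Z) ω) := hZ'.neg.ennreal_ofReal
  have hb : ∀ (a : ι → ℝ) (Y : Ω → ℝ), Measurable Y → (∀ ω, |Y ω| ≤ |Z ω|) →
      Integrable (fun ω => Real.exp (∑ i, a i * U ω i) * Y ω) P := by
    intro a Y hY hle
    refine (hint a).mono (Measurable.aestronglyMeasurable (by fun_prop)) (.of_forall fun ω => ?_)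
    simp only [norm_mul, Real.norm_eq_abs]
    exact mul_le_mul_of_nonneg_left (hle ω) (abs_nonneg _)
  have hb1 : ∀ a : ι → ℝ,
      Integrable (fun ω => Real.exp (∑ i, a i * U ω i) * max (Z ω) 0) P := fun a => by
    refine hb a _ (by fun_prop) fun ω => ?_
    rw [abs_of_nonneg (le_max_right _ _)]
    exact max_le (le_abs_self _) (abs_nonneg _)
  have hb2 : ∀ a : ι → ℝ,
      Integrable (fun ω => Real.exp (∑ i, a i * U ω i) * max ((-Z) ω) 0) P := fun a => by
    refine hb a _ (hZ'.neg.max measurable_const) fun ω => ?_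
    rw [abs_of_nonneg (le_max_right _ _)]
    exact max_le (neg_le_abs _) (abs_nonneg _)
  -- The positive and negative parts of `Z`, taken as densities, give finite measures under which
  -- `U` has the same exponential moments.
  have hmap : (P.withDensity fun ω => ENNReal.ofReal (Z ω)).map U =
      (P.withDensity fun ω => ENNReal.ofReal ((-Z) ω)).map U := by
    refine map_pi_eq_of_integral_exp_eq hU (fun a => ?_) (fun a => ?_)
    · rw [integrable_withDensity_iff hm1 (.of_forall fun _ => ENNReal.ofReal_lt_top)]
      simp only [hpos]
      exact hb1 a
    · rw [integral_withDensity_eq_integral_toReal_smul hm1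
        (.of_forall fun _ => ENNReal.ofReal_lt_top),
        integral_withDensity_eq_integral_toReal_smul hm2
        (.of_forall fun _ => ENNReal.ofReal_lt_top)]
      simp only [hpos, smul_eq_mul, mul_comm (max _ _)]
      rw [← sub_eq_zero, ← integral_sub (hb1 a) (hb2 a)]
      refine (integral_congr_ae (.of_forall fun ω => ?_)).trans (h a)
      simp only [Pi.neg_apply]
      rw [← mul_sub]
      congr 1
      rcases le_total 0 (Z ω) with h0 | h0
      · rw [max_eq_left h0, max_eq_right (by linarith)]; ring
      · rw [max_eq_right h0, max_eq_left (by linarith)]; ring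
  -- Equal image measures say that `Z` integrates to zero over every event `U ∈ S`; as `Z` is a
  -- function of `U`, these events suffice.
  refine ae_eq_of_forall_setIntegral_eq_of_sigmaFinite' hU.comap_le
    (fun s _ _ => hZ.integrableOn) (fun s _ _ => (integrable_zero _ _ _).integrableOn) ?_ hZm
    aestronglyMeasurable_zero
  rintro s ⟨S, hS, rfl⟩ -
  rw [integral_eq_lintegral_pos_part_sub_lintegral_neg_part hZ.integrableOn]
  have h1 := congrArg (fun μ => μ S) hmap
  simp only [Measure.map_apply hU hS, withDensity_apply _ (hU hS)] at h1
  rw [h1]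
  simp

end Separation

/-! ### Chaos components of functions of finitely many Wiener integrals -/

section Expansion

variable {Ω : Type*} [MeasurableSpace Ω] {P : Measure Ω} [IsProbabilityMeasure P] {τ : ℝ}
  {W : TimeL2 τ →ₗ[ℝ] Lp ℝ 2 P} {ι : Type*} [Fintype ι]

/-- The vector `(W(u_i))_i`. -/
noncomputable def gaussVec (W : TimeL2 τ →ₗ[ℝ] Lp ℝ 2 P) (u : ι → TimeL2 τ) (ω : Ω) (i : ι) : ℝ := W (u i) ω

omit [IsProbabilityMeasure P] [Fintype ι] in
lemma measurable_gaussVec (u : ι → TimeL2 τ) : Measurable (gaussVec W u) :=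
  measurable_pi_lambda _ fun i => (Lp.stronglyMeasurable (W (u i))).measurable

/-- The `σ`-algebra generated by the `W(u_i)`. -/
noncomputable abbrev gaussAlgebra (W : TimeL2 τ →ₗ[ℝ] Lp ℝ 2 P) (u : ι → TimeL2 τ) : MeasurableSpace Ω :=
  MeasurableSpace.comap (gaussVec W u) inferInstance

lemma wick_ae_eq_exp (hW : IsWienerIntegral W) (u : ι → TimeL2 τ) (a : ι → ℝ) :
    hW.wick (∑ i, a i • u i) =ᵐ[P] fun ω =>
      Real.exp (∑ i, a i * gaussVec W u ω i) * Real.exp (-(‖∑ i, a i • u i‖ ^ 2 / 2)) := by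
  filter_upwards [hW.coeFn_wick (∑ i, a i • u i), map_sum_smul_ae (W := W) u a] with ω h1 h2
  rw [h1, wickFun, h2, ← Real.exp_add, sub_eq_add_neg]
  rfl

lemma wick_mem_lpMeas (hW : IsWienerIntegral W) (u : ι → TimeL2 τ) (a : ι → ℝ) :
    hW.wick (∑ i, a i • u i) ∈ lpMeas ℝ ℝ (gaussAlgebra W u) 2 P := by
  rw [mem_lpMeas_iff_aestronglyMeasurable]
  refine ⟨_, ?_, wick_ae_eq_exp hW u a⟩
  have h1 : Measurable fun x : ι → ℝ =>
      Real.exp (∑ i, a i * x i) * Real.exp (-(‖∑ i, a i • u i‖ ^ 2 / 2)) := by fun_prop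
  exact (h1.comp (comap_measurable (gaussVec W u))).stronglyMeasurable

omit [IsProbabilityMeasure P] [Fintype ι] in
lemma isClosed_lpMeas (u : ι → TimeL2 τ) :
    IsClosed (lpMeas ℝ ℝ (gaussAlgebra W u) 2 P : Set (Lp ℝ 2 P)) := by
  have : Fact (gaussAlgebra W u ≤ ‹MeasurableSpace Ω›) := ⟨(measurable_gaussVec u).comap_le⟩
  have : CompleteSpace (lpMeas ℝ ℝ (gaussAlgebra W u) 2 P) := inferInstance
  exact (completeSpace_coe_iff_isComplete.1 this).isClosed

lemma eq_zero_of_mem_lpMeas (hW : IsWienerIntegral W) (u : ι → TimeL2 τ) {Z : Lp ℝ 2 P}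
    (hZ : Z ∈ lpMeas ℝ ℝ (gaussAlgebra W u) 2 P)
    (h : ∀ a : ι → ℝ, inner ℝ (hW.wick (∑ i, a i • u i)) Z = 0) : Z = 0 := by
  rw [mem_lpMeas_iff_aestronglyMeasurable] at hZ
  have key : ∀ a : ι → ℝ, (fun ω => hW.wick (∑ i, a i • u i) ω * Z ω) =ᵐ[P] fun ω =>
      Real.exp (-(‖∑ i, a i • u i‖ ^ 2 / 2)) *
        (Real.exp (∑ i, a i * gaussVec W u ω i) * Z ω) := fun a => by
    filter_upwards [wick_ae_eq_exp hW u a] with ω hω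
    rw [hω]; ring
  refine (Lp.eq_zero_iff_ae_eq_zero).2 (ae_eq_zero_of_integral_exp_mul_eq_zero
    (measurable_gaussVec u) hZ (Lp.stronglyMeasurable Z).measurable (fun a => ?_) fun a => ?_)
  · have h1 : Integrable (fun ω => hW.wick (∑ i, a i • u i) ω * Z ω) P :=
      (Lp.memLp _).integrable_mul (Lp.memLp Z)
    have h2 := (h1.congr (key a))
    exact (integrable_const_mul_iff (isUnit_iff_ne_zero.2 (Real.exp_pos _).ne') _).1 h2
  · have h1 := h a
    rw [inner_eq_integral, integral_congr_ae (key a), integral_const_mul] at h1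
    exact (mul_eq_zero.1 h1).resolve_left (Real.exp_pos _).ne'

/-- Exponential vectors are total in the square integrable functions of `(W(u_i))_i`. -/
lemma lpMeas_le_closure_span_wick (hW : IsWienerIntegral W) (u : ι → TimeL2 τ) :
    lpMeas ℝ ℝ (gaussAlgebra W u) 2 P ≤
      (Submodule.span ℝ
        (Set.range fun a : ι → ℝ => hW.wick (∑ i, a i • u i))).topologicalClosure := by
  intro Z hZ
  set D := (Submodule.span ℝ
    (Set.range fun a : ι → ℝ => hW.wick (∑ i, a i • u i))).topologicalClosure with hD
  have hDM : D ≤ lpMeas ℝ ℝ (gaussAlgebra W u) 2 P :=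
    Submodule.topologicalClosure_minimal _
      (Submodule.span_le.2 (Set.range_subset_iff.2 (wick_mem_lpMeas hW u))) (isClosed_lpMeas u)
  have : CompleteSpace D := (Submodule.isClosed_topologicalClosure _).completeSpace_coe
  -- The residual is still a function of the `W(u_i)` and is orthogonal to all exponential vectors
  -- over their span.
  have h1 : Z - D.starProjection Z = 0 := by
    refine eq_zero_of_mem_lpMeas hW u
      (Submodule.sub_mem _ hZ (hDM (D.starProjection_apply_mem Z))) fun a => ?_
    exact (Submodule.mem_orthogonal _ _).1 (D.sub_starProjection_mem_orthogonal Z) _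
      (Submodule.le_topologicalClosure _ (Submodule.subset_span ⟨a, rfl⟩))
  rw [sub_eq_zero.1 h1]
  exact D.starProjection_apply_mem Z

omit [IsProbabilityMeasure P] in
lemma eq_zero_of_hasSum_pow_mul {a : ℕ → ℝ} (h : ∀ t : ℝ, HasSum (fun n => t ^ n * a n) 0)
    (n : ℕ) : a n = 0 := by
  have h1 : HasFPowerSeriesAt (0 : ℝ → ℝ) (FormalMultilinearSeries.ofScalars ℝ a) 0 := by
    rw [hasFPowerSeriesAt_iff]
    refine .of_forall fun t => ?_
    simpa [FormalMultilinearSeries.coeff_ofScalars] using h t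
  rw [← FormalMultilinearSeries.coeff_ofScalars (𝕜 := ℝ) (p := a) (n := n), h1.eq_zero]
  rfl

/-- The chaos components of an exponential vector are functions of `(W(u_i))_i`. -/
lemma starProjection_wick_mem_lpMeas (hτ : 0 < τ) (hW : IsWienerIntegral W) (u : ι → TimeL2 τ)
    (a : ι → ℝ) (n : ℕ) : (chaos W n).starProjection (hW.wick (∑ i, a i • u i)) ∈
      lpMeas ℝ ℝ (gaussAlgebra W u) 2 P := by
  set M := lpMeas ℝ ℝ (gaussAlgebra W u) 2 P with hM
  have : CompleteSpace M := (isClosed_lpMeas u).completeSpace_coe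
  -- For `φ` orthogonal to `M`, the pairing with `wick(t h)`, `h = ∑ a_i u_i`, is zero for every
  -- `t`, since `t h` stays in the span. The coefficients of this power series are the pairings with
  -- the components of `wick(h)`.
  rw [← M.orthogonal_orthogonal, Submodule.mem_orthogonal]
  intro φ hφ
  refine eq_zero_of_hasSum_pow_mul (a := fun n =>
    inner ℝ φ ((chaos W n).starProjection (hW.wick (∑ i, a i • u i)))) (fun t => ?_) n
  have h1 := hasSum_inner_wick hτ hW φ (∑ i, a i • u i) t
  have h2 : t • ∑ i, a i • u i = ∑ i, (t * a i) • u i := by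
    simp only [Finset.smul_sum, mul_smul]
  rw [h2, (Submodule.mem_orthogonal' _ _).1 hφ _ (wick_mem_lpMeas hW u _)] at h1
  exact h1

lemma lpMeas_le_chaos (hτ : 0 < τ) (hW : IsWienerIntegral W) (u : ι → TimeL2 τ) :
    lpMeas ℝ ℝ (gaussAlgebra W u) 2 P ≤ (⨆ n, chaos W n).topologicalClosure := by
  refine (lpMeas_le_closure_span_wick hW u).trans
    (Submodule.topologicalClosure_minimal _ (Submodule.span_le.2 ?_)
      (Submodule.isClosed_topologicalClosure _))
  rintro _ ⟨a, rfl⟩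
  exact (wick_chaos hτ hW _).1

lemma starProjection_mem_lpMeas (hτ : 0 < τ) (hW : IsWienerIntegral W) (u : ι → TimeL2 τ)
    {F : Lp ℝ 2 P} (hF : F ∈ lpMeas ℝ ℝ (gaussAlgebra W u) 2 P) (n : ℕ) :
    (chaos W n).starProjection F ∈ lpMeas ℝ ℝ (gaussAlgebra W u) 2 P := by
  have h1 : lpMeas ℝ ℝ (gaussAlgebra W u) 2 P ≤
      (lpMeas ℝ ℝ (gaussAlgebra W u) 2 P).comap
        ((chaos W n).starProjection : Lp ℝ 2 P →ₗ[ℝ] Lp ℝ 2 P) := by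
    refine (lpMeas_le_closure_span_wick hW u).trans
      (Submodule.topologicalClosure_minimal _ (Submodule.span_le.2 ?_)
        ((isClosed_lpMeas u).preimage (chaos W n).starProjection.continuous))
    rintro _ ⟨a, rfl⟩
    exact starProjection_wick_mem_lpMeas hτ hW u a n
  exact h1 hF

/-- A square integrable function of `(W(u_i))_i` has a chaos expansion, and all components of its
expansions are functions of `(W(u_i))_i`. -/
lemma isChaosExpansion_of_aestronglyMeasurable (hτ : 0 < τ) (hW : IsWienerIntegral W)
    (u : ι → TimeL2 τ) {X : Ω → ℝ} (hX : MemLp X 2 P)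
    (hXm : AEStronglyMeasurable[gaussAlgebra W u] X P) :
    (∃ f, IsChaosExpansion W f X) ∧ ∀ f, IsChaosExpansion W f X → ∀ n,
      AEStronglyMeasurable[gaussAlgebra W u] (multipleIntegral W n (f n)) P := by
  have hF : hX.toLp X ∈ lpMeas ℝ ℝ (gaussAlgebra W u) 2 P := by
    rw [mem_lpMeas_iff_aestronglyMeasurable]
    exact hXm.congr hX.coeFn_toLp.symm
  refine ⟨exists_isChaosExpansion hW (lpMeas_le_chaos hτ hW u hF) hX.coeFn_toLp,
    fun f hf n => ?_⟩
  rw [hf.multipleIntegral_eq hW hX.coeFn_toLp, ← mem_lpMeas_iff_aestronglyMeasurable (𝕜 := ℝ)]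
  exact starProjection_mem_lpMeas hτ hW u hF n

end Expansion

/-! ### Exponential and Bernoulli laws -/

section Laws

lemma measurable_real_sign : Measurable Real.sign := by
  unfold Real.sign
  exact Measurable.ite measurableSet_Iio measurable_const
    (Measurable.ite measurableSet_Ioi measurable_const measurable_const)

lemma charFun_expMeasure_one (t : ℝ) : charFun (expMeasure 1) t = (1 - t * Complex.I)⁻¹ := by
  rw [charFun_apply_real, expMeasure, gammaMeasure]
  have hpdf : ∀ x, gammaPDF 1 1 x = exponentialPDF 1 x := fun x => rfl
  have hm : Measurable (gammaPDF 1 1) := (measurable_gammaPDFReal 1 1).ennreal_ofReal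
  have hlt : ∀ᵐ x, gammaPDF 1 1 x < ∞ := .of_forall fun _ => ENNReal.ofReal_lt_top
  rw [integral_withDensity_eq_integral_toReal_smul hm hlt]
  have h1 : ∀ x : ℝ, (gammaPDF 1 1 x).toReal • Complex.exp (t * x * Complex.I) =
      (Set.Ici (0 : ℝ)).indicator
        (fun x : ℝ => Complex.exp ((-1 + t * Complex.I) * x)) x := by
    intro x
    rw [hpdf, exponentialPDF_eq]
    by_cases hx : 0 ≤ x
    · rw [if_pos hx, Set.indicator_of_mem (Set.mem_Ici.2 hx), ENNReal.toReal_ofReal (by positivity),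
        Complex.real_smul]
      push_cast
      rw [one_mul, ← Complex.exp_add]
      congr 1; ring
    · rw [if_neg hx, Set.indicator_of_notMem (by simpa using hx)]
      simp
  rw [integral_congr_ae (.of_forall h1), integral_indicator measurableSet_Ici,
    integral_Ici_eq_integral_Ioi, integral_exp_mul_complex_Ioi (by simp)]
  simp only [Complex.ofReal_zero, mul_zero, Complex.exp_zero]
  rw [neg_div, ← div_neg, one_div]
  congr 1; ring

/-- The integral itself is a complex square root. Squaring avoids the choice of a branch and is what
the sum of two independent copies requires. -/
lemma integral_cexp_sq_gaussianReal_sq (t : ℝ) :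
    (∫ x : ℝ, Complex.exp (t * (1 / 2 * x ^ 2 : ℝ) * Complex.I) ∂gaussianReal 0 1) ^ 2 =
      (1 - t * Complex.I)⁻¹ := by
  rw [integral_gaussianReal_eq_integral_smul one_ne_zero]
  have hb : 0 < ((1 - t * Complex.I) / 2).re := by simp
  have hb0 : (1 - t * Complex.I) ≠ 0 := fun h => by simp [h] at hb
  have h1 : ∀ x : ℝ, gaussianPDFReal 0 1 x • Complex.exp (t * (1 / 2 * x ^ 2 : ℝ) * Complex.I) =
      ((√(2 * Real.pi))⁻¹ : ℝ) * Complex.exp (-((1 - t * Complex.I) / 2) * (x : ℂ) ^ 2) := by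
    intro x
    rw [gaussianPDFReal, Complex.real_smul]
    push_cast
    rw [mul_assoc, ← Complex.exp_add]
    congr 2
    · simp
    · ring
  simp only [h1]
  rw [integral_const_mul, integral_gaussian_complex hb, mul_pow, ← Complex.ofReal_pow, inv_pow,
    Real.sq_sqrt (by positivity), ← Complex.cpow_nat_mul]
  have h2 : ((2 : ℕ) : ℂ) * (1 / 2) = 1 := by norm_num
  rw [h2, Complex.cpow_one]
  have : (Real.pi : ℂ) ≠ 0 := by exact_mod_cast Real.pi_ne_zero
  push_cast
  field_simp

variable {Ω : Type*} [MeasurableSpace Ω] {P : Measure Ω}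

/-- Half the sum of the squares of two independent standard normal variables is exponential. -/
lemma hasLaw_half_sum_sq [IsProbabilityMeasure P] {X Y : Ω → ℝ}
    (hX : HasLaw X (gaussianReal 0 1) P) (hY : HasLaw Y (gaussianReal 0 1) P)
    (hXY : IndepFun X Y P) :
    HasLaw (fun ω => 1 / 2 * (X ω ^ 2 + Y ω ^ 2)) (expMeasure 1) P := by
  have hXm := hX.aemeasurable
  have hYm := hY.aemeasurable
  have hsq : ∀ {Z : Ω → ℝ}, HasLaw Z (gaussianReal 0 1) P → ∀ t : ℝ,
      charFun (P.map fun ω => 1 / 2 * Z ω ^ 2) t =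
        ∫ x : ℝ, Complex.exp (t * (1 / 2 * x ^ 2 : ℝ) * Complex.I) ∂gaussianReal 0 1 := by
    intro Z hZ t
    have hZm := hZ.aemeasurable
    rw [charFun_apply_real, integral_map (by fun_prop) (by fun_prop), ← hZ.map_eq,
      integral_map hZm (by fun_prop)]
  have hm : AEMeasurable (fun ω => 1 / 2 * (X ω ^ 2 + Y ω ^ 2)) P := by fun_prop
  refine ⟨hm, ?_⟩
  have := Measure.isProbabilityMeasure_map hm
  have := isProbabilityMeasure_expMeasure (r := 1) one_pos
  refine Measure.ext_of_charFun (funext fun t => ?_)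
  have h1 : (fun ω => 1 / 2 * (X ω ^ 2 + Y ω ^ 2)) =
      fun ω => 1 / 2 * X ω ^ 2 + 1 / 2 * Y ω ^ 2 := by ext ω; ring
  have hind : IndepFun (fun ω => 1 / 2 * X ω ^ 2) (fun ω => 1 / 2 * Y ω ^ 2) P :=
    hXY.comp (φ := fun x => 1 / 2 * x ^ 2) (ψ := fun x => 1 / 2 * x ^ 2) (by fun_prop)
      (by fun_prop)
  rw [h1, hind.charFun_map_fun_add_eq_mul (by fun_prop) (by fun_prop), Pi.mul_apply, hsq hX, hsq hY,
    ← pow_two, integral_cexp_sq_gaussianReal_sq, charFun_expMeasure_one]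

lemma gaussianReal_singleton_zero : gaussianReal 0 1 {0} = 0 :=
  gaussianReal_absolutelyContinuous 0 one_ne_zero (by simp)

lemma gaussianReal_Iic_eq_Ioi : gaussianReal 0 1 (Set.Iic 0) = gaussianReal 0 1 (Set.Ioi 0) := by
  have h1 : gaussianReal 0 1 (Set.Iic 0) = gaussianReal 0 1 (Set.Iio 0) := by
    refine measure_congr ?_
    have : ∀ᵐ x ∂gaussianReal 0 1, x ≠ 0 := by
      rw [ae_iff]; simpa using gaussianReal_singleton_zero
    filter_upwards [this] with x hx
    exact propext ⟨fun h => lt_of_le_of_ne h hx, fun h => le_of_lt h⟩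
  have h2 := gaussianReal_map_neg (μ := 0) (v := 1)
  rw [neg_zero] at h2
  rw [h1]
  nth_rw 2 [← h2]
  rw [Measure.map_apply measurable_neg measurableSet_Ioi]
  congr 1
  ext x; simp

lemma gaussianReal_Ioi : gaussianReal 0 1 (Set.Ioi 0) = 2⁻¹ := by
  have h1 := measure_add_measure_compl (μ := gaussianReal 0 1) (s := Set.Ioi (0 : ℝ))
    measurableSet_Ioi
  rw [Set.compl_Ioi, gaussianReal_Iic_eq_Ioi, measure_univ, ← two_mul] at h1
  exact ENNReal.eq_inv_of_mul_eq_one_left (by rw [mul_comm]; exact h1)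

/-- The sign of a standard normal variable is a fair coin. -/
lemma hasLaw_half_sign_add_half {X : Ω → ℝ} (hX : HasLaw X (gaussianReal 0 1) P) :
    HasLaw (fun ω => 1 / 2 * Real.sign (X ω) + 1 / 2)
      (bernoulliMeasure (1 : ℝ) 0 ⟨1 / 2, by norm_num, by norm_num⟩) P := by
  have hm : Measurable fun x => 1 / 2 * Real.sign x + 1 / 2 :=
    (measurable_real_sign.const_mul _).add_const _
  refine ⟨hm.comp_aemeasurable hX.aemeasurable, ?_⟩
  have h1 : P.map (fun ω => 1 / 2 * Real.sign (X ω) + 1 / 2) =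
      (gaussianReal 0 1).map fun x => 1 / 2 * Real.sign x + 1 / 2 := by
    rw [← hX.map_eq, AEMeasurable.map_map_of_aemeasurable hm.aemeasurable hX.aemeasurable]
    rfl
  -- The map is `1` on the positive half-line and, off the null set `{0}` where it equals `1/2`, it
  -- is `0` on the complement.
  have h2 : ((gaussianReal 0 1).restrict (Set.Ioi 0)).map
      (fun x => 1 / 2 * Real.sign x + 1 / 2) =
      ((gaussianReal 0 1).restrict (Set.Ioi 0)).map fun _ => (1 : ℝ) := by
    refine Measure.map_congr ?_
    filter_upwards [ae_restrict_mem measurableSet_Ioi] with x hx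
    rw [Real.sign_of_pos hx]; norm_num
  have h3 : ((gaussianReal 0 1).restrict (Set.Ioi 0)ᶜ).map
      (fun x => 1 / 2 * Real.sign x + 1 / 2) =
      ((gaussianReal 0 1).restrict (Set.Ioi 0)ᶜ).map fun _ => (0 : ℝ) := by
    refine Measure.map_congr ?_
    have : ∀ᵐ x ∂gaussianReal 0 1, x ≠ 0 := by
      rw [ae_iff]; simpa using gaussianReal_singleton_zero
    filter_upwards [ae_restrict_mem measurableSet_Ioi.compl, ae_restrict_of_ae this] with x hx hx0
    rw [Real.sign_of_neg (lt_of_le_of_ne (by simpa using hx) hx0)]; norm_num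
  rw [h1, ← Measure.restrict_add_restrict_compl (μ := gaussianReal 0 1) (s := Set.Ioi (0 : ℝ))
    measurableSet_Ioi, Measure.map_add _ _ hm, h2, h3, Measure.map_const, Measure.map_const,
    Measure.restrict_apply_univ, Measure.restrict_apply_univ, Set.compl_Ioi,
    gaussianReal_Iic_eq_Ioi, gaussianReal_Ioi, bernoulliMeasure_def]
  have h4 : ((2⁻¹ : ℝ≥0) : ℝ≥0∞) = 2⁻¹ := by rw [ENNReal.coe_inv two_ne_zero]; rfl
  congr 1
  · ext s hs
    rw [Measure.smul_apply, Measure.smul_apply, ← h4]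
    have : unitInterval.toNNReal ⟨1 / 2, by norm_num, by norm_num⟩ = (2⁻¹ : ℝ≥0) := by
      ext; simp
    rw [this]; rfl
  · ext s hs
    rw [Measure.smul_apply, Measure.smul_apply, ← h4]
    have : unitInterval.toNNReal (unitInterval.symm ⟨1 / 2, by norm_num, by norm_num⟩) =
        (2⁻¹ : ℝ≥0) := by
      ext; simp; norm_num
    rw [this]; rfl

end Laws

/-! ### Independence of orthogonal blocks -/

section Blocks

variable {Ω : Type*} [MeasurableSpace Ω] {P : Measure Ω} [IsProbabilityMeasure P] {τ : ℝ}
  {W : TimeL2 τ →ₗ[ℝ] Lp ℝ 2 P} {ι κ : Type*} [Fintype ι] [Fintype κ]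

/-- The regrouped vector is Gaussian, and only covariances between different blocks have to vanish;
inside a block vectors may even repeat. -/
lemma IsWienerIntegral.iIndepFun_blocks (hW : IsWienerIntegral W) {v : ι → κ → TimeL2 τ}
    (hv : ∀ i j, i ≠ j → ∀ k l, inner ℝ (v i k) (v j l) = 0) :
    iIndepFun (fun i => gaussVec W (v i)) P := by
  let L : (ι × κ → ℝ) →L[ℝ] (ι → κ → ℝ) := ContinuousLinearMap.pi fun i =>
    ContinuousLinearMap.pi fun k => ContinuousLinearMap.proj (i, k)
  have h1 : HasGaussianLaw (fun ω i k => W (v i k) ω) P :=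
    (hW.hasGaussianLaw fun p : ι × κ => v p.1 p.2).map_fun L
  exact h1.iIndepFun_of_covariance_eval (X := fun i k => (W (v i k) : Ω → ℝ))
    fun i j hij k l => by rw [hW.covariance_eq, hv i j hij]

lemma IsWienerIntegral.indepFun_gaussVec (hW : IsWienerIntegral W) {u : ι → TimeL2 τ}
    {v : κ → TimeL2 τ} (huv : ∀ i k, inner ℝ (u i) (v k) = 0) :
    IndepFun (gaussVec W u) (gaussVec W v) P := by
  let L : (ι ⊕ κ → ℝ) →L[ℝ] (ι → ℝ) × (κ → ℝ) := ContinuousLinearMap.prod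
    (ContinuousLinearMap.pi fun i => ContinuousLinearMap.proj (Sum.inl i))
    (ContinuousLinearMap.pi fun k => ContinuousLinearMap.proj (Sum.inr k))
  have h1 : HasGaussianLaw (fun ω => (fun i => W (u i) ω, fun k => W (v k) ω)) P :=
    (hW.hasGaussianLaw (Sum.elim u v)).map_fun L
  exact h1.indepFun_of_covariance_eval (X := fun i => (W (u i) : Ω → ℝ))
    (Y := fun k => (W (v k) : Ω → ℝ)) fun i k => by rw [hW.covariance_eq, huv i k]

omit [IsProbabilityMeasure P] in
lemma indepFun_of_aestronglyMeasurable_comap {E E' : Type*} [MeasurableSpace E]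
    [MeasurableSpace E'] {U : Ω → E} {V : Ω → E'} (hUV : IndepFun U V P) {F G : Ω → ℝ}
    (hF : AEStronglyMeasurable[MeasurableSpace.comap U inferInstance] F P)
    (hG : AEStronglyMeasurable[MeasurableSpace.comap V inferInstance] G P) : IndepFun F G P := by
  obtain ⟨F', hF', hFF'⟩ := hF
  obtain ⟨G', hG', hGG'⟩ := hG
  refine IndepFun.congr ?_ hFF'.symm hGG'.symm
  rw [IndepFun_iff_Indep] at hUV ⊢
  exact indep_of_indep_of_le_left (indep_of_indep_of_le_right hUV hG'.measurable.comap_le)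
    hF'.measurable.comap_le

end Blocks

/-! ### The variables of the proposition -/

section Admissible

variable {Ω : Type*} [MeasurableSpace Ω] {P : Measure Ω} [IsProbabilityMeasure P] {τ : ℝ}
  {W : TimeL2 τ →ₗ[ℝ] Lp ℝ 2 P} {h : Fin 5 → TimeL2 τ}

lemma exists_isAdmissible (hτ : 0 < τ) (hW : IsWienerIntegral W) :
    ∃ h : Fin 5 → TimeL2 τ, IsAdmissible W h := by
  -- The witnesses are the normalized indicators of five consecutive intervals of length `τ / 5`.
  let A : Fin 5 → Set ℝ := fun i => Set.Ioo (i * (τ / 5)) ((i + 1) * (τ / 5))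
  have hτ5 : 0 < τ / 5 := by positivity
  have hA : IsDisjointFamily τ A := by
    refine ⟨fun i => measurableSet_Ioo, fun i x hx => ?_, ?_⟩
    · have hi : ((i : ℕ) : ℝ) + 1 ≤ 5 := by exact_mod_cast i.2
      have h1 : 0 ≤ (i : ℝ) * (τ / 5) := by positivity
      exact ⟨h1.trans_lt hx.1, hx.2.trans_le (by nlinarith)⟩
    · have key : ∀ i j : Fin 5, i < j → Disjoint (A i) (A j) := by
        intro i j hij
        rw [Set.disjoint_left]
        intro x hx hy
        have h1 : ((i : ℕ) : ℝ) + 1 ≤ (j : ℕ) := by exact_mod_cast hij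
        have := hx.2.trans_le (mul_le_mul_of_nonneg_right h1 hτ5.le)
        exact lt_asymm this hy.1
      intro i j hij
      rcases lt_or_gt_of_ne hij with h1 | h1
      · exact key i j h1
      · exact (key j i h1).symm
  let e : Fin 5 → TimeL2 τ := fun i => timeIndicator τ (hA.measurableSet i)
  have he : ∀ i, ‖e i‖ ≠ 0 := by
    intro i h0
    have h1 := norm_timeIndicator_sq (τ := τ) (hA.measurableSet i)
    rw [show ‖timeIndicator τ (hA.measurableSet i)‖ = 0 from h0, measureReal_def,
      Measure.restrict_apply (hA.measurableSet i), Set.inter_eq_left.2 (hA.subset i),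
      Real.volume_Ioo, ENNReal.toReal_ofReal (by linarith)] at h1
    linarith
  refine ⟨fun i => ‖e i‖⁻¹ • e i, fun i => ?_, ?_⟩
  · rw [norm_smul, norm_inv, norm_norm, inv_mul_cancel₀ (he i)]
  · intro i j hij
    refine (hW.iIndepFun_of_orthogonal (u := fun i => ‖e i‖⁻¹ • e i)
      fun i j hij => ?_).indepFun hij
    beta_reduce
    rw [inner_smul_left, inner_smul_right, hA.inner_timeIndicator hij, mul_zero, mul_zero]

lemma IsAdmissible.inner_eq_zero (hh : IsAdmissible W h) (hW : IsWienerIntegral W) {i j : Fin 5}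
    (hij : i ≠ j) : inner ℝ (h i) (h j) = 0 :=
  hW.inner_eq_zero_of_indepFun (hh.2 hij)

omit [IsProbabilityMeasure P] in
lemma IsAdmissible.hasLaw (hh : IsAdmissible W h) (hW : IsWienerIntegral W) (i : Fin 5) :
    HasLaw (W (h i)) (gaussianReal 0 1) P := by
  have h1 : ‖h i‖₊ ^ 2 = 1 := by
    ext; simp [hh.1 i]
  simpa only [h1] using hW (h i)

lemma IsAdmissible.iIndepFun_varA_varB_varPi (hh : IsAdmissible W h) (hW : IsWienerIntegral W) :
    iIndepFun ![varA W h, varB W h, varPi W h] P := by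
  -- The vector `h 2` is repeated so that all three blocks have the same index type.
  let v : Fin 3 → Fin 2 → TimeL2 τ := ![![h 0, h 1], ![h 3, h 4], ![h 2, h 2]]
  have hv : ∀ i j, i ≠ j → ∀ k l, inner ℝ (v i k) (v j l) = 0 := by
    intro i j hij k l
    fin_cases i <;> fin_cases j <;> first | exact absurd rfl hij | skip
    all_goals fin_cases k <;> fin_cases l <;> exact hh.inner_eq_zero hW (by decide)
  let q : (Fin 2 → ℝ) → ℝ := fun x => 1 / 2 * (x 0 ^ 2 + x 1 ^ 2)
  let s : (Fin 2 → ℝ) → ℝ := fun x => 1 / 2 * Real.sign (x 0) + 1 / 2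
  have hq : Measurable q := by fun_prop
  have hs : Measurable s :=
    ((measurable_real_sign.comp (measurable_pi_apply 0)).const_mul _).add_const _
  have h1 := (hW.iIndepFun_blocks hv).comp ![q, q, s] fun i => by
    fin_cases i
    exacts [hq, hq, hs]
  convert h1 using 1
  ext i ω
  fin_cases i <;> rfl

lemma abs_real_sign_le (x : ℝ) : |Real.sign x| ≤ 1 := by
  rcases Real.sign_apply_eq x with h | h | h <;> simp [h]

omit [IsProbabilityMeasure P] in
-- Gaussian variables have fourth moments; Hölder with `1/4 + 1/4 = 1/2`.
lemma IsWienerIntegral.memLp_sq (hW : IsWienerIntegral W) (g : TimeL2 τ) :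
    MemLp (fun ω => W g ω ^ 2) 2 P := by
  have h4 : MemLp (W g) 4 P := (hW g).hasGaussianLaw.memLp (by simp)
  have : ENNReal.HolderTriple 4 4 2 := ⟨by
    rw [← two_mul, show (4 : ℝ≥0∞) = 2 * 2 by norm_num, ENNReal.mul_inv (by simp) (by simp),
      ← mul_assoc, ENNReal.mul_inv_cancel (by simp) (by simp), one_mul]⟩
  simpa only [pow_two] using h4.mul' h4

omit [IsProbabilityMeasure P] in
lemma memLp_varA (hW : IsWienerIntegral W) (h : Fin 5 → TimeL2 τ) : MemLp (varA W h) 2 P :=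
  ((hW.memLp_sq (h 0)).add (hW.memLp_sq (h 1))).const_mul (1 / 2)

omit [IsProbabilityMeasure P] in
lemma memLp_varB (hW : IsWienerIntegral W) (h : Fin 5 → TimeL2 τ) : MemLp (varB W h) 2 P :=
  ((hW.memLp_sq (h 3)).add (hW.memLp_sq (h 4))).const_mul (1 / 2)

lemma memLp_varX (hW : IsWienerIntegral W) (h : Fin 5 → TimeL2 τ) : MemLp (varX W h) 2 P :=
  (memLp_varA hW h).sub (memLp_const 1)

omit [IsProbabilityMeasure P] in
lemma measurable_varPi (h : Fin 5 → TimeL2 τ) : Measurable (varPi W h) :=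
  ((measurable_real_sign.comp (Lp.stronglyMeasurable (W (h 2))).measurable).const_mul _).add_const _

lemma memLp_varY (hW : IsWienerIntegral W) (h : Fin 5 → TimeL2 τ) : MemLp (varY W h) 2 P := by
  have h1 : MemLp (fun ω => 2 * varPi W h ω) ∞ P :=
    memLp_top_of_bound ((measurable_varPi h).const_mul 2).aestronglyMeasurable 2
      (.of_forall fun ω => by
        rw [Real.norm_eq_abs, varPi, abs_le]
        have := abs_le.1 (abs_real_sign_le (W (h 2) ω))
        constructor <;> linarith)
  exact ((memLp_varB hW h).mul' h1).sub (memLp_const 1)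

/-- The components of `X` are functions of `W(h₁), W(h₂)` and those of `Y` of `W(h₃), W(h₄), W(h₅)`;
these two blocks are independent. -/
lemma IsAdmissible.stronglyIndependent (hτ : 0 < τ) (hh : IsAdmissible W h)
    (hW : IsWienerIntegral W) : StronglyIndependent W (varX W h) (varY W h) := by
  have hu : Measurable fun x : Fin 2 → ℝ => 1 / 2 * (x 0 ^ 2 + x 1 ^ 2) - 1 := by fun_prop
  have hs : Measurable fun x : Fin 3 → ℝ => Real.sign (x 0) :=
    measurable_real_sign.comp (measurable_pi_apply 0)
  have hv : Measurable fun x : Fin 3 → ℝ =>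
      2 * (1 / 2 * Real.sign (x 0) + 1 / 2) * (1 / 2 * (x 1 ^ 2 + x 2 ^ 2)) - 1 := by fun_prop
  have hX := isChaosExpansion_of_aestronglyMeasurable hτ hW ![h 0, h 1] (memLp_varX hW h)
    (hu.comp (comap_measurable _)).stronglyMeasurable.aestronglyMeasurable
  have hY := isChaosExpansion_of_aestronglyMeasurable hτ hW ![h 2, h 3, h 4] (memLp_varY hW h)
    (hv.comp (comap_measurable _)).stronglyMeasurable.aestronglyMeasurable
  have huv : IndepFun (gaussVec W ![h 0, h 1]) (gaussVec W ![h 2, h 3, h 4]) P := by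
    refine hW.indepFun_gaussVec fun i k => ?_
    fin_cases i <;> fin_cases k <;> exact hh.inner_eq_zero hW (by decide)
  exact ⟨hX.1, hY.1, fun f g hf hg n m =>
    indepFun_of_aestronglyMeasurable_comap huv (hX.2 f hf n) (hY.2 g hg m)⟩

lemma integral_sign_gaussianReal : ∫ x, Real.sign x ∂gaussianReal 0 1 = 0 := by
  have h1 := gaussianReal_map_neg (μ := 0) (v := 1)
  rw [neg_zero] at h1
  have h2 : ∫ x, Real.sign x ∂gaussianReal 0 1 = -∫ x, Real.sign x ∂gaussianReal 0 1 := by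
    conv_lhs => rw [← h1, integral_map measurable_neg.aemeasurable
      measurable_real_sign.aestronglyMeasurable]
    rw [← integral_neg]
    simp only [Real.sign_neg]
  linarith

lemma integrable_sign_mul {μ : Measure ℝ} {f : ℝ → ℝ} (hf : Integrable f μ) :
    Integrable (fun x => Real.sign x * f x) μ :=
  hf.bdd_mul measurable_real_sign.aestronglyMeasurable (.of_forall abs_real_sign_le)

/-- As `sign` has mean zero, `exp x` may be replaced by `exp x - 1`, which has the sign of `x`. -/
lemma integral_sign_mul_exp_gaussianReal_pos :
    0 < ∫ x, Real.sign x * Real.exp x ∂gaussianReal 0 1 := by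
  have he : Integrable Real.exp (gaussianReal 0 1) := by
    simpa using integrable_exp_mul_gaussianReal (μ := 0) (v := 1) 1
  have hint : Integrable (fun x => Real.sign x * (Real.exp x - 1)) (gaussianReal 0 1) :=
    integrable_sign_mul (he.sub (integrable_const 1))
  have h1 : ∫ x, Real.sign x * (Real.exp x - 1) ∂gaussianReal 0 1 =
      ∫ x, Real.sign x * Real.exp x ∂gaussianReal 0 1 := by
    have h2 : Integrable Real.sign (gaussianReal 0 1) := by
      simpa using integrable_sign_mul (integrable_const (μ := gaussianReal 0 1) (1 : ℝ))
    simp only [mul_sub, mul_one]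
    rw [integral_sub (integrable_sign_mul he) h2, integral_sign_gaussianReal, sub_zero]
  have hpos : ∀ x : ℝ, x ≠ 0 → 0 < Real.sign x * (Real.exp x - 1) := by
    intro x hx
    rcases lt_or_gt_of_ne hx with h | h
    · rw [Real.sign_of_neg h]
      have := Real.exp_lt_one_iff.mpr h
      linarith
    · rw [Real.sign_of_pos h]
      have := Real.one_lt_exp_iff.2 h
      linarith
  rw [← h1, integral_pos_iff_support_of_nonneg _ hint]
  · have h3 : Set.Ioi 0 ⊆ Function.support fun x : ℝ => Real.sign x * (Real.exp x - 1) :=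
      fun x hx => (hpos x (ne_of_gt hx)).ne'
    refine lt_of_lt_of_le ?_ (measure_mono h3)
    rw [gaussianReal_Ioi]
    simp
  · intro x
    rcases eq_or_ne x 0 with rfl | hx
    · simp
    · exact (hpos x hx).le

lemma IsAdmissible.integral_varB (hh : IsAdmissible W h) (hW : IsWienerIntegral W) :
    ∫ ω, varB W h ω ∂P = 1 := by
  have h1 : ∀ i, ∫ ω, W (h i) ω ^ 2 ∂P = 1 := by
    intro i
    have := hW.integral_sq (h i)
    rw [hh.1 i, one_pow] at this
    simpa only [pow_two] using this
  simp only [varB]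
  rw [integral_const_mul, integral_add ((hW.memLp_sq _).integrable one_le_two)
    ((hW.memLp_sq _).integrable one_le_two), h1, h1]
  norm_num

omit [IsProbabilityMeasure P] in
lemma IsWienerIntegral.integral_wickFun (hW : IsWienerIntegral W) (g : TimeL2 τ) :
    ∫ ω, wickFun W g ω ∂P = 1 := by
  simp only [wickFun, sub_eq_add_neg, Real.exp_add]
  rw [integral_mul_const, hW.integral_exp, ← Real.exp_add, add_neg_cancel, Real.exp_zero]

/-- Pairing `Y` with an exponential vector in the direction `h₃` only sees the sign. -/
lemma IsAdmissible.integral_varY_mul_wickFun (hh : IsAdmissible W h) (hW : IsWienerIntegral W)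
    (t : ℝ) :
    ∫ ω, varY W h ω * wickFun W (t • h 2) ω ∂P =
      ∫ ω, Real.sign (W (h 2) ω) * wickFun W (t • h 2) ω ∂P := by
  -- With `W(t h₃)` as a coordinate of its own, `wickFun` is pointwise a function of the vector, not
  -- just almost everywhere.
  have hind : IndepFun (gaussVec W ![h 2, t • h 2]) (gaussVec W ![h 3, h 4]) P := by
    refine hW.indepFun_gaussVec fun i k => ?_
    have h23 : inner ℝ (h 2) (h 3) = 0 := hh.inner_eq_zero hW (by decide)
    have h24 : inner ℝ (h 2) (h 4) = 0 := hh.inner_eq_zero hW (by decide)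
    fin_cases i <;> fin_cases k <;> simp [inner_smul_left, h23, h24]
  have hw : Integrable (wickFun W (t • h 2)) P := (hW.memLp_wickFun _).integrable one_le_two
  have hsm : AEStronglyMeasurable (fun ω => Real.sign (W (h 2) ω)) P :=
    (measurable_real_sign.comp (Lp.stronglyMeasurable (W (h 2))).measurable).aestronglyMeasurable
  have hsw : Integrable (fun ω => Real.sign (W (h 2) ω) * wickFun W (t • h 2) ω) P :=
    hw.bdd_mul hsm (.of_forall fun ω => abs_real_sign_le _)
  -- As `2ϖ = sign(W(h₃)) + 1`, the integrand is `U B` minus the exponential vector; `E[B] = 1` and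
  -- the exponential vector has mean 1, so the sign term is left.
  let U : Ω → ℝ := fun ω =>
    Real.sign (W (h 2) ω) * wickFun W (t • h 2) ω + wickFun W (t • h 2) ω
  have hUint : Integrable U P := hsw.add hw
  have hs0 : Measurable fun x : Fin 2 → ℝ => Real.sign (x 0) :=
    measurable_real_sign.comp (measurable_pi_apply 0)
  have hUB : IndepFun U (varB W h) P :=
    hind.comp (φ := fun x : Fin 2 → ℝ => Real.sign (x 0) * Real.exp (x 1 - ‖t • h 2‖ ^ 2 / 2) +
        Real.exp (x 1 - ‖t • h 2‖ ^ 2 / 2))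
      (ψ := fun x : Fin 2 → ℝ => 1 / 2 * (x 0 ^ 2 + x 1 ^ 2)) (by fun_prop) (by fun_prop)
  have hB : Integrable (varB W h) P := (memLp_varB hW h).integrable one_le_two
  have h1 : ∀ ω, varY W h ω * wickFun W (t • h 2) ω = U ω * varB W h ω - wickFun W (t • h 2) ω := by
    intro ω
    simp only [varY, varPi, U]
    ring
  simp only [h1]
  have hUB' : Integrable (fun ω => U ω * varB W h ω) P := hUB.integrable_mul hUint hB
  rw [integral_sub hUB' hw,
    hUB.integral_fun_mul_eq_mul_integral hUint.1 hB.1, hh.integral_varB hW, mul_one,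
    integral_add hsw hw, hW.integral_wickFun]
  ring

lemma IsAdmissible.infinite_chaos_varY (hτ : 0 < τ) (hh : IsAdmissible W h)
    (hW : IsWienerIntegral W) {g : ∀ n, KernelL2 τ n} (hg : IsChaosExpansion W g (varY W h)) :
    {n | multipleIntegral W n (g n) ≠ 0}.Infinite := by
  intro hfin
  let F : Lp ℝ 2 P := (memLp_varY hW h).toLp
  have hF : F =ᵐ[P] varY W h := (memLp_varY hW h).coeFn_toLp
  let φ : ℝ → ℝ := fun t => ∫ ω, Real.sign (W (h 2) ω) * wickFun W (t • h 2) ω ∂P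
  have hφ : ∀ t, inner ℝ F (hW.wick (t • h 2)) = φ t := by
    intro t
    refine (inner_eq_integral _ _).trans (Eq.trans ?_ (hh.integral_varY_mul_wickFun hW t))
    refine integral_congr_ae ?_
    filter_upwards [hF, hW.coeFn_wick (t • h 2)] with ω h1 h2
    rw [h1, h2]
  let c : ℕ → ℝ := fun n => inner ℝ F ((chaos W n).starProjection (hW.wick (h 2)))
  have hc : ∀ n, n ∉ hfin.toFinset → c n = 0 := by
    intro n hn
    have h1 : multipleIntegral W n (g n) = 0 := by simpa using hn
    rw [hg.multipleIntegral_eq hW hF] at h1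
    simp only [c]
    rw [← Submodule.inner_starProjection_left_eq_right, h1, inner_zero_left]
  -- Only finitely many coefficients of the power series `φ` survive, and a polynomial bounded on
  -- the real line is constant.
  let p : Polynomial ℝ := ∑ n ∈ hfin.toFinset, Polynomial.monomial n (c n)
  have hp : ∀ t, p.eval t = φ t := by
    intro t
    have h1 := hasSum_inner_wick hτ hW F (h 2) t
    have h2 : HasSum (fun n => t ^ n * c n) (∑ n ∈ hfin.toFinset, t ^ n * c n) :=
      hasSum_sum_of_ne_finset_zero fun n hn => by rw [hc n hn, mul_zero]
    rw [← hφ t, h1.unique h2, Polynomial.eval_finsetSum]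
    exact Finset.sum_congr rfl fun n _ => by rw [Polynomial.eval_monomial, mul_comm]
  have hbdd : ∀ t, |φ t| ≤ 1 := by
    intro t
    rw [← hW.integral_wickFun (t • h 2), ← Real.norm_eq_abs]
    refine norm_integral_le_of_norm_le ((hW.memLp_wickFun _).integrable one_le_two)
      (.of_forall fun ω => ?_)
    have h0 : 0 ≤ wickFun W (t • h 2) ω := (Real.exp_pos _).le
    rw [norm_mul, Real.norm_eq_abs, Real.norm_of_nonneg h0]
    exact mul_le_of_le_one_left h0 (abs_real_sign_le _)
  have hdeg : p.degree ≤ 0 := by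
    rw [← Polynomial.isBoundedUnder_abs_atTop_iff]
    exact Filter.isBoundedUnder_of ⟨1, fun t => by rw [hp]; exact hbdd t⟩
  -- This is contradictory: `φ 0` is the mean of the sign, which is zero by symmetry, whereas `φ 1`
  -- is positive.
  have h01 : φ 1 = φ 0 := by
    rw [← hp, ← hp, Polynomial.eq_C_of_degree_le_zero hdeg, Polynomial.eval_C, Polynomial.eval_C]
  have hlaw := hh.hasLaw hW 2
  have h0 : φ 0 = 0 := by
    have h1 : φ 0 = ∫ ω, Real.sign (W (h 2) ω) ∂P := by
      exact integral_congr_ae (.of_forall fun ω => by simp [wickFun])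
    rw [h1, ← integral_sign_gaussianReal]
    exact hlaw.integral_comp (f := Real.sign) measurable_real_sign.aestronglyMeasurable
  have h1 : φ 1 = (∫ x, Real.sign x * Real.exp x ∂gaussianReal 0 1) * Real.exp (-(1 / 2)) := by
    rw [← integral_mul_const, ← hlaw.integral_comp
      (f := fun x => Real.sign x * Real.exp x * Real.exp (-(1 / 2)))
      ((measurable_real_sign.mul Real.measurable_exp).mul_const _).aestronglyMeasurable]
    refine integral_congr_ae (.of_forall fun ω => ?_)
    simp only [wickFun, one_smul, hh.1 2, one_pow, sub_eq_add_neg, Real.exp_add,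
      Function.comp_apply, mul_assoc]
  have h2 := mul_pos integral_sign_mul_exp_gaussianReal_pos (Real.exp_pos (-(1 / 2)))
  rw [← h1, h01, h0] at h2
  exact lt_irrefl _ h2

end Admissible

end WienerChaos

theorem mainTheorem7 {Ω : Type*} [MeasurableSpace Ω] (P : Measure Ω) [IsProbabilityMeasure P]
    (τ : ℝ) (hτ : 0 < τ) (W : WienerChaos.TimeL2 τ →ₗ[ℝ] Lp ℝ 2 P)
    (hW : WienerChaos.IsWienerIntegral W) :
    (∃ h : Fin 5 → WienerChaos.TimeL2 τ, WienerChaos.IsAdmissible W h) ∧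
    ∀ h : Fin 5 → WienerChaos.TimeL2 τ, WienerChaos.IsAdmissible W h →
      HasLaw (WienerChaos.varA W h) (expMeasure 1) P ∧
      HasLaw (WienerChaos.varB W h) (expMeasure 1) P ∧
      HasLaw (WienerChaos.varPi W h)
        (bernoulliMeasure (1 : ℝ) 0 ⟨1 / 2, by norm_num, by norm_num⟩) P ∧
      iIndepFun ![WienerChaos.varA W h, WienerChaos.varB W h, WienerChaos.varPi W h] P ∧
      WienerChaos.StronglyIndependent W (WienerChaos.varX W h) (WienerChaos.varY W h) ∧
      ∀ g, WienerChaos.IsChaosExpansion W g (WienerChaos.varY W h) →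
        {n | WienerChaos.multipleIntegral W n (g n) ≠ 0}.Infinite :=
  ⟨WienerChaos.exists_isAdmissible hτ hW, fun _ hh =>
    ⟨WienerChaos.hasLaw_half_sum_sq (hh.hasLaw hW 0) (hh.hasLaw hW 1) (hh.2 (by decide)),
      WienerChaos.hasLaw_half_sum_sq (hh.hasLaw hW 3) (hh.hasLaw hW 4) (hh.2 (by decide)),
      WienerChaos.hasLaw_half_sign_add_half (hh.hasLaw hW 2),
      hh.iIndepFun_varA_varB_varPi hW,
      hh.stronglyIndependent hτ hW,
      fun _ hg => hh.infinite_chaos_varY hτ hW hg⟩⟩
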